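/- Let $S$ be a finite set and $M=(m_{s,t})_{s,t\in S}$ a symmetric matrix with $m_{s,s}=1$ and $m_{s,t}\in\{2,3,\dots\}\cup\{\infty\}$ for $s\neq t$. Let $$A_S=\langle S\mid \underbrace{sts\cdots}_{m_{s,t}}=\underbrace{tst\cdots}_{m_{s,t}}\ \ (s\neq t,\ m_{s,t}\neq\infty)\rangle$$ be the associated Artin–Tits group, and suppose that it is of spherical type, i.e. that the Coxeter group $W_S$ of $M$ (the quotient of $A_S$ by the relations $s^2=1$, $s\in S$) is finite. Let $X\subset S$ be any subset (possibly empty or decomposable), let $A_X$ be the subgroup and $A_X^+$ the submonoid of $A_S$ generated by $X$. Then there is a unique element $\Delta_X\in A_X^+$ which is the least common multiple of $X$ in the monoid $A_X^+$, both for left divisibility ($b=ac$ with $c\in A_X^+$) and for right divisibility ($b=ca$ with $c\in A_X^+$), and $\Delta_X$ or $\Delta_X^2$ is central in $A_X$. Let $\epsilon\in\{1,2\}$ be minimal such that $\Delta_X^\epsilon$ is central in $A_X$. Then $$Z_{A_S}(\Delta_X^\epsilon)=\mathrm{Com}_{A_S}(A_X)=N_{A_S}(A_X)=A_X\cdot QZ_{A_S}(A_X),$$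 where $Z_{A_S}(\Delta_X^\epsilon)$ is the centralizer of $\Delta_X^\epsilon$ in $A_S$, $\mathrm{Com}_{A_S}(A_X)$ is the set of $g\in A_S$ such that $gA_Xg^{-1}\cap A_X$ has finite index in both $A_X$ and $gA_Xg^{-1}$, $N_{A_S}(A_X)=\{g\in A_S\mid gX\subset A_Xg\}$, which coincides with the normalizer $\{g\in A_S\mid gA_Xg^{-1}=A_X\}$, and $QZ_{A_S}(A_X)=\{g\in A_S\mid gX=Xg\}$. -/

import Mathlib

open scoped Pointwise

namespace ArtinTits

section Group

variable {G : Type*} [Group G]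

/-- In a submonoid `P` of a group, `a` divides `b` on the left: `b = a c` with `c ∈ P`. -/
def LeftDvdIn (P : Submonoid G) (a b : G) : Prop := ∃ c ∈ P, b = a * c

/-- In a submonoid `P` of a group, `a` divides `b` on the right: `b = c a` with `c ∈ P`. -/
def RightDvdIn (P : Submonoid G) (a b : G) : Prop := ∃ c ∈ P, b = c * a

/-- `m` is a least common multiple in `P` of the elements of `Y`, with respect to the
divisibility relation `dvd` on `P`. -/
structure IsLcmIn (P : Submonoid G) (dvd : G → G → Prop) (Y : Set G) (m : G) : Prop where
  mem : m ∈ P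
  dvd_of_mem : ∀ y ∈ Y, dvd y m
  dvd_of_common : ∀ n ∈ P, (∀ y ∈ Y, dvd y n) → dvd m n

/-- The center of a subgroup `H`, seen inside the ambient group. -/
def centerOf (H : Subgroup G) : Subgroup G := H ⊓ Subgroup.centralizer (H : Set G)

/-- The set `{g ∈ G | g Y = Y g}`. -/
def quasiCentralizer (Y : Set G) : Set G :=
  {g | (fun y => g * y) '' Y = (fun y => y * g) '' Y}

/-- The set `{g ∈ G | g Y ⊆ ⟨Y⟩ g}`, with `⟨Y⟩` the subgroup generated by `Y`. -/
def normalizingSet (Y : Set G) : Set G :=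
  {g | (fun y => g * y) '' Y ⊆ (fun a => a * g) '' (Subgroup.closure Y : Set G)}

end Group

section Artin

variable {S : Type*} (M : CoxeterMatrix S)

/-- The braid word `⋯ s t s t` with `m_{s,t}` letters, in the free group. -/
def braidProd (s t : S) : FreeGroup S :=
  ((CoxeterSystem.braidWord M s t).map FreeGroup.of).prod

/-- The braid relators. As usual for `CoxeterMatrix`, the entry `0` stands for `m_{s,t} = ∞`. -/
def braidRelators : Set (FreeGroup S) :=
  {r | ∃ s t : S, s ≠ t ∧ M s t ≠ 0 ∧ r = braidProd M s t * (braidProd M t s)⁻¹}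

/-- The Artin–Tits group `A_S` of a Coxeter matrix. -/
abbrev ArtinGroup : Type _ := PresentedGroup (braidRelators M)

/-- The generator of `A_S` attached to `s`. -/
def gen (s : S) : ArtinGroup M := PresentedGroup.of s

/-- The matrix is of spherical type: its Coxeter group is finite. -/
def IsSpherical : Prop := Finite M.Group

/-- A subset `X` of `S`, seen as a set of elements of `A_S`. -/
def gens (X : Set S) : Set (ArtinGroup M) := gen M '' X

/-- The standard parabolic subgroup `A_X` generated by `X` in `A_S`. -/
def parabolic (X : Set S) : Subgroup (ArtinGroup M) := Subgroup.closure (gens M X)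

/-- The monoid `A_X⁺` generated by `X` in `A_S`. -/
def parabolicMonoid (X : Set S) : Submonoid (ArtinGroup M) := Submonoid.closure (gens M X)

/-- `Δ` is the element `Δ_X`: the least common multiple of `X` in the monoid `A_X⁺`,
both for left divisibility and for right divisibility. -/
def IsDelta (X : Set S) (Δ : ArtinGroup M) : Prop :=
  IsLcmIn (parabolicMonoid M X) (LeftDvdIn (parabolicMonoid M X)) (gens M X) Δ ∧
    IsLcmIn (parabolicMonoid M X) (RightDvdIn (parabolicMonoid M X)) (gens M X) Δ

end Artin

end ArtinTits

/-!
Let `M⁺` be the monoid with the presentation of the Artin–Tits group `A`, and call an element of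
`M⁺` simple if its words are reduced words of the finite Coxeter group `W`.

**The monoid.** The local lcm property says that an equality `s a = t b` in `M⁺` comes from
`s = t` and `a = b`, or from a common factor, the braid word on `s` and `t`
(`localLcm`). It is proved by induction on the length, and for a fixed length by induction on a
derivation of the equality. The essential case is transitivity with three distinct letters
(`Completes.trans`), where an element `e` is a multiple of the two braid words on `u, s` and on
`u, t` deprived of their first letter `u`. In the weak order, below `u w₀` with `w₀` the longest
element of `W`, these two have a common multiple dividing `e` (`LocalLcm.directed`), and Matsumoto's
theorem (`IsSimple.eq_of_proj_eq`) exhibits the braid word on `s, t` in it. What is needed from `W`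
is that an element with left descents `s` and `t` is a reduced multiple of the longest element of
`⟨s, t⟩` (`CoxeterSystem.exists_wordProd_altList_mul`), that every element is a reduced left factor
of `w₀` (`CoxeterSystem.length_add_of_maximal`), both consequences of the exchange condition, and
that `s t` has order exactly `m_{s,t}` in `W`, which follows from the geometric representation
(`CoxeterSystem.orderOf_simple_mul_simple`).

Consequently `M⁺` is cancellative. The greatest simple element `Δ_T` of the submonoid generated
by `T` is the lcm of `T` on both sides, it permutes `T` by conjugation, and its square is central
there. Every element of `M⁺` divides a power of `Δ_S ^ 2`, so `M⁺` embeds in `A` by the Ore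
construction (`toGroup_injective`).

**Ribbons.** Suppose that `r ∈ M⁺` is not divisible on the right by a letter of `X`, and that
`r Δ_X ^ k = q r` with `q ∈ M⁺` and `k ≥ 1`. If `s` is the last letter of `r`, both `s` and `X`
divide `r Δ_X ^ k` on the right, hence so does `Δ_{X ∪ {s}} = d Δ_X`. Removing the factors `Δ_X` one
by one shows that `d` divides `r` on the right. As `d` conjugates `X` to another set of generators,
induction shows that `r` does too (`exists_conjugates_of_mul_delta_pow`).

**The theorem.** Each of the conditions in the statement implies that `g` conjugates some power of
`Δ_X ^ 2` into `A_X`. Multiplying by a central element makes `g` positive. Splitting off the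
greatest left divisor of `g` in the parabolic submonoid makes the conjugate of the power of `Δ_X`
positive, and splitting off letters of `X` on the right leaves a ribbon `r`, whose conjugation maps
`X` injectively into `X`. So `g ∈ A_X · QZ(A_X)` (`exists_eq_mul_conjugates`,
`mem_mul_quasiCentralizer`). The reverse inclusions are direct: an element of `QZ(A_X)` normalizes
`A_X` and commutes with `Δ_X` (`Conjugates.mul_delta`).
-/

/-! ### The exchange condition in a Coxeter group -/

namespace CoxeterSystem

variable {B W : Type*} [Group W] {M : CoxeterMatrix B} (cs : CoxeterSystem M W)

open Classical in
/-- The action of the simple reflection `s i` on pairs `(t, ε)`: it conjugates `t`, and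
flips the sign `ε` exactly when `t = s i`. -/
noncomputable def signMap (i : B) : Function.End (W × ZMod 2) :=
  fun p => (cs.simple i * p.1 * cs.simple i, p.2 + if p.1 = cs.simple i then 1 else 0)

open Classical in
theorem prod_map_signMap (ω : List B) (t : W) (ε : ZMod 2) :
    (ω.map cs.signMap).prod (t, ε) =
      (cs.wordProd ω * t * (cs.wordProd ω)⁻¹, ε + ((cs.rightInvSeq ω).count t : ℕ)) := by
  induction ω with
  | nil => simp [Function.End.one_def]
  | cons i ω ih =>
    rw [List.map_cons, List.prod_cons]
    change cs.signMap i ((ω.map cs.signMap).prod (t, ε)) = _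
    rw [ih]
    have h : (cs.wordProd ω * t * (cs.wordProd ω)⁻¹ = cs.simple i) ↔
        ((cs.wordProd ω)⁻¹ * cs.simple i * cs.wordProd ω = t) := by
      constructor <;> (intro h; rw [← h]; group)
    simp only [signMap, rightInvSeq, List.count_cons, wordProd_cons, mul_inv_rev, inv_simple,
      mul_assoc, beq_iff_eq] at h ⊢
    simp only [h]
    split_ifs <;> simp [add_assoc]

theorem alternatingWord_two_mul_succ (i j : B) (k : ℕ) :
    alternatingWord i j (2 * (k + 1)) = alternatingWord i j (2 * k) ++ [i, j] := by
  rw [show 2 * (k + 1) = 2 * k + 1 + 1 by ring, alternatingWord_succ, alternatingWord_succ]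
  simp

theorem prod_map_alternatingWord_two_mul {G : Type*} [Monoid G] (f : B → G) (i j : B) (k : ℕ) :
    ((alternatingWord i j (2 * k)).map f).prod = (f i * f j) ^ k := by
  induction k with
  | zero => simp [alternatingWord]
  | succ k ih =>
    rw [alternatingWord_two_mul_succ, List.map_append, List.prod_append, ih, pow_succ]
    simp

open Classical in
/-- Along the relator `(s i * s j) ^ m`, every reflection is crossed an even number of times. -/
theorem even_count_leftInvSeq_alternatingWord (i j : B) (t : W) :
    Even ((cs.leftInvSeq (alternatingWord i j (2 * M i j))).count t) := by
  set m := M i j with hm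
  have hl : cs.leftInvSeq (alternatingWord i j (2 * m)) =
      (List.range (2 * m)).map fun k => cs.simple i * (cs.simple j * cs.simple i) ^ k := by
    apply List.ext_getElem
    · simp
    · intro k h1 h2
      have hk : k < 2 * m := by simpa using h2
      rw [cs.getElem_leftInvSeq_alternatingWord i j m k hk, prod_alternatingWord_eq_mul_pow]
      have : ¬ Even (2 * k + 1) := by simp
      simp [this, show (2 * k + 1) / 2 = k by omega]
  have hp : (cs.simple j * cs.simple i) ^ m = 1 := by
    rw [hm, M.symmetric i j]; exact cs.simple_mul_simple_pow j i
  rw [hl, two_mul, List.range_add, List.map_append, List.count_append, List.map_map]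
  have : (fun k => cs.simple i * (cs.simple j * cs.simple i) ^ k) ∘ (fun x => m + x) =
      fun k => cs.simple i * (cs.simple j * cs.simple i) ^ k := by
    funext k; simp [pow_add, hp]
  rw [this]
  exact ⟨_, rfl⟩

theorem isLiftable_signMap : M.IsLiftable cs.signMap := by
  intro i j
  rw [← prod_map_alternatingWord_two_mul]
  funext ⟨t, ε⟩
  classical
  have hr : alternatingWord i j (2 * M i j) = (alternatingWord j i (2 * M j i)).reverse := by
    rw [M.symmetric i j]
    generalize M j i = m
    apply List.ext_getElem
    · simp
    · intro k h1 h2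
      have hk : k < 2 * m := by simpa using h1
      rw [List.getElem_reverse, getElem_alternatingWord _ _ _ _ hk,
        getElem_alternatingWord _ _ _ _ (by simp; omega)]
      simp only [length_alternatingWord]
      have : Even (2 * m + k) ↔ ¬ Even (2 * m + (2 * m - 1 - k)) := by
        rw [Nat.even_iff, Nat.even_iff]; omega
      by_cases h : Even (2 * m + k) <;> simp_all
  have hw : cs.wordProd (alternatingWord i j (2 * M i j)) = 1 := by
    rw [wordProd, prod_map_alternatingWord_two_mul, simple_mul_simple_pow]
  rw [prod_map_signMap, hw]
  have he : Even ((cs.rightInvSeq (alternatingWord i j (2 * M i j))).count t) := by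
    rw [hr, rightInvSeq_reverse, List.count_reverse]
    exact cs.even_count_leftInvSeq_alternatingWord j i t
  rw [(ZMod.natCast_eq_zero_iff_even).2 he]
  simp [Function.End.one_def]

/-- The action of `W` on pairs `(t, ε)` extending `signMap`. Its second component detects the
reflections that shorten `w`, see `inversionParity_eq_one_iff`. -/
noncomputable def signHom : W →* Function.End (W × ZMod 2) :=
  cs.lift ⟨cs.signMap, cs.isLiftable_signMap⟩

open Classical in
theorem signHom_wordProd (ω : List B) (t : W) (ε : ZMod 2) :
    cs.signHom (cs.wordProd ω) (t, ε) =
      (cs.wordProd ω * t * (cs.wordProd ω)⁻¹, ε + ((cs.rightInvSeq ω).count t : ℕ)) := by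
  rw [← prod_map_signMap, wordProd, map_list_prod, List.map_map]
  have h : ⇑cs.signHom ∘ cs.simple = cs.signMap :=
    funext fun i => cs.lift_apply_simple cs.isLiftable_signMap i
  rw [h]

/-- The parity of the number of occurrences of `t` in the right inversion sequence of any word
for `w`. -/
noncomputable def inversionParity (w t : W) : ZMod 2 := (cs.signHom w (t, 0)).2

theorem signHom_apply (w t : W) (ε : ZMod 2) :
    cs.signHom w (t, ε) = (w * t * w⁻¹, ε + cs.inversionParity w t) := by
  obtain ⟨ω, -, rfl⟩ := cs.exists_isReduced w
  simp [inversionParity, signHom_wordProd]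

theorem inversionParity_mul (w w' t : W) :
    cs.inversionParity (w * w') t =
      cs.inversionParity w' t + cs.inversionParity w (w' * t * w'⁻¹) := by
  have h : cs.signHom (w * w') (t, 0) = cs.signHom w (cs.signHom w' (t, 0)) := by
    rw [map_mul]; rfl
  rw [signHom_apply, signHom_apply, signHom_apply] at h
  simpa using congrArg Prod.snd h

theorem inversionParity_one (t : W) : cs.inversionParity 1 t = 0 := by
  simp [inversionParity, Function.End.one_def]

theorem inversionParity_simple_self (i : B) :
    cs.inversionParity (cs.simple i) (cs.simple i) = 1 := by
  simp [inversionParity, signHom, signMap]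

theorem IsReflection.inversionParity_self {t : W} (ht : cs.IsReflection t) :
    cs.inversionParity t t = 1 := by
  obtain ⟨u, i, rfl⟩ := ht
  have h1 := cs.inversionParity_mul u u⁻¹ (u * cs.simple i * u⁻¹)
  rw [mul_inv_cancel, inversionParity_one] at h1
  rw [inversionParity_mul, inversionParity_mul]
  have e1 : u⁻¹ * (u * cs.simple i * u⁻¹) * u⁻¹⁻¹ = cs.simple i := by group
  rw [e1] at h1 ⊢
  have e2 : cs.simple i * cs.simple i * (cs.simple i)⁻¹ = cs.simple i := by group
  rw [e2, inversionParity_simple_self, add_left_comm, ← h1, add_zero]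

theorem inversionParity_eq_one_iff {t : W} (ht : cs.IsReflection t) (w : W) :
    cs.inversionParity w t = 1 ↔ cs.length (w * t) < cs.length w := by
  have key : ∀ w, cs.inversionParity w t = 1 → cs.length (w * t) < cs.length w := by
    intro w hw
    classical
    obtain ⟨ω, hω, rfl⟩ := cs.exists_isReduced w
    have hc : ((cs.rightInvSeq ω).count t : ZMod 2) = 1 := by
      simpa [inversionParity, signHom_wordProd] using hw
    have hmem : t ∈ cs.rightInvSeq ω := by
      by_contra h
      rw [List.count_eq_zero_of_not_mem h] at hc
      simp at hc
    exact (cs.isRightInversion_of_mem_rightInvSeq hω hmem).2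
  refine ⟨key w, fun h => ?_⟩
  by_contra hne
  have h0 : cs.inversionParity w t = 0 := by
    revert hne
    generalize cs.inversionParity w t = z
    revert z
    decide
  have h1 : cs.inversionParity (w * t) t = 1 := by
    rw [inversionParity_mul, ht.inversionParity_self]
    simp [ht.inv, ht.mul_self, h0]
  have := key _ h1
  rw [mul_assoc, ht.mul_self, mul_one] at this
  omega

/-- A form of the strong exchange condition: a reflection that shortens a product shortens
one of the factors, after conjugation in the case of the right-hand one. -/
theorem IsReflection.exchange {t : W} (ht : cs.IsReflection t) {x y : W}
    (h : cs.length (t * (x * y)) < cs.length (x * y)) :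
    cs.length (t * x) < cs.length x ∨ cs.length (x⁻¹ * t * x * y) < cs.length y := by
  have hconj : cs.IsReflection (x⁻¹ * t * x) := by simpa using ht.conj x⁻¹
  rw [← cs.length_inv, ← cs.length_inv (x * y)] at h
  rw [← cs.length_inv, ← cs.length_inv x, ← cs.length_inv (_ * y), ← cs.length_inv y]
  simp only [mul_inv_rev, ht.inv] at h ⊢
  have e : y⁻¹ * (x⁻¹ * (t * x⁻¹⁻¹)) = y⁻¹ * (x⁻¹ * t * x) := by group
  rw [e, ← cs.inversionParity_eq_one_iff ht, ← cs.inversionParity_eq_one_iff hconj]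
  rw [← cs.inversionParity_eq_one_iff ht, inversionParity_mul, inv_inv] at h
  generalize cs.inversionParity x⁻¹ t = a at *
  generalize cs.inversionParity y⁻¹ (x⁻¹ * t * x) = b at *
  revert a b
  decide

theorem length_simple_mul_lt_or (i : B) (w : W) :
    cs.length (cs.simple i * w) < cs.length w ∨ cs.length (cs.simple i * w) = cs.length w + 1 := by
  have := cs.length_simple_mul w i
  omega

/-- An element of maximal length has every element of the group as a reduced left factor. -/
theorem length_add_of_maximal {w₀ : W} (hw : ∀ v, cs.length v ≤ cs.length w₀) (v : W) :
    cs.length v + cs.length (v⁻¹ * w₀) = cs.length w₀ := by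
  obtain ⟨n, hn⟩ : ∃ n, cs.length v = n := ⟨_, rfl⟩
  induction n generalizing v with
  | zero => rw [cs.length_eq_zero_iff] at hn; simp [hn]
  | succ n ih =>
    have hv : v ≠ 1 := by rintro rfl; simp at hn
    obtain ⟨i, hi⟩ := cs.exists_rightDescent_of_ne_one hv
    rw [cs.isRightDescent_iff] at hi
    set v' := v * cs.simple i with hv'
    have hvv : v = v' * cs.simple i := by simp [hv']
    have h1 := ih v' (by omega)
    have ht : cs.IsReflection (v' * cs.simple i * v'⁻¹) := ⟨v', i, rfl⟩
    have hlt : cs.length (v' * cs.simple i * v'⁻¹ * (v' * (v'⁻¹ * w₀))) <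
        cs.length (v' * (v'⁻¹ * w₀)) := by
      rw [mul_inv_cancel_left]
      exact lt_of_le_of_ne (hw _) (ht.length_mul_right_ne w₀)
    rcases ht.exchange _ hlt with h | h
    · rw [inv_mul_cancel_right, ← hvv] at h
      omega
    · have e : v'⁻¹ * (v' * cs.simple i * v'⁻¹) * v' * (v'⁻¹ * w₀) = v⁻¹ * w₀ := by
        rw [hvv]; simp [mul_assoc]
      rw [e] at h
      have e2 : cs.simple i * (v'⁻¹ * w₀) = v⁻¹ * w₀ := by rw [hvv]; simp [mul_assoc]
      have := cs.length_simple_mul (v'⁻¹ * w₀) i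
      rw [e2] at this
      omega

end CoxeterSystem

/-! ### The geometric representation and the order of a product of two simple reflections -/

namespace CoxeterMatrix

variable {B : Type*} (M : CoxeterMatrix B)

/-- The Cartan matrix `-2 cos (π / m_{i,j})`. The convention `m_{i,j} = 0` for `∞` gives the
usual entry `-2`, since `π / 0 = 0` in Lean. -/
noncomputable def cartan (i j : B) : ℝ := -(2 * Real.cos (Real.pi / M i j))

theorem cartan_self (i : B) : M.cartan i i = 2 := by simp [cartan]

theorem cartan_comm (i j : B) : M.cartan i j = M.cartan j i := by
  rw [cartan, cartan, M.symmetric]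

/-- The reflection attached to `i` in the dual `B → ℝ` of the geometric representation. -/
noncomputable def dualReflection (i : B) : (B → ℝ) ≃ₗ[ℝ] (B → ℝ) :=
  Module.reflection (x := M.cartan i) (f := LinearMap.proj i) (by simp [cartan_self])

theorem dualReflection_apply (i : B) (v : B → ℝ) (j : B) :
    M.dualReflection i v j = v j - v i * M.cartan i j := by
  simp [dualReflection, Module.reflection_apply]

theorem isLiftable_dualReflection : M.IsLiftable M.dualReflection := by
  intro i j
  by_cases hij : i = j
  · subst hij
    ext v k
    simp [dualReflection_apply, cartan_self]
    ring
  have hm1 : M i j ≠ 1 := M.off_diagonal i j hij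
  rcases Nat.eq_zero_or_pos (M i j) with h0 | hpos
  · rw [h0, pow_zero]
  ext v : 1
  rw [dualReflection, dualReflection, Module.reflection_mul_reflection_pow_apply]
  simp only [LinearMap.proj_apply]
  set θ : ℝ := Real.pi / M i j with hθ
  have hcij : M.cartan i j = -(2 * Real.cos θ) := rfl
  have hcji : M.cartan j i = -(2 * Real.cos θ) := by rw [cartan_comm]; rfl
  have ht : M.cartan j i * M.cartan i j - 2 = 2 * Real.cos (2 * θ) := by
    rw [hcij, hcji, Real.cos_two_mul]; ring
  rw [ht]
  rcases eq_or_ne (M i j) 2 with h2 | h2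
  · have hθ2 : Real.cos θ = 0 := by rw [hθ, h2]; simp
    have hc : 2 * Real.cos (2 * θ) = -2 := by rw [Real.cos_two_mul, hθ2]; ring
    rw [hc, h2]
    norm_num [hcij, hcji, hθ2, Polynomial.Chebyshev.S_eval_neg_two]
    abel
  · have hm3 : 3 ≤ M i j := by omega
    have hmR : (3 : ℝ) ≤ M i j := by exact_mod_cast hm3
    have hpi := Real.pi_pos
    have hmθ : M i j * θ = Real.pi := by rw [hθ]; field_simp
    have hs : Real.sin (2 * θ) ≠ 0 := by
      apply ne_of_gt
      apply Real.sin_pos_of_pos_of_lt_pi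
      · positivity
      · nlinarith [show 0 < θ by positivity]
    have hS : ∀ n : ℤ, (Polynomial.Chebyshev.S ℝ n).eval (2 * Real.cos (2 * θ)) =
        Real.sin ((n + 1) * (2 * θ)) / Real.sin (2 * θ) := fun n => by
      rw [← Polynomial.Chebyshev.S_two_mul_real_cos, mul_div_cancel_right₀ _ hs]
    simp only [hS]
    rcases Nat.even_or_odd' (M i j) with ⟨n, hn | hn⟩
    · have e1 : ((M i j : ℤ) - 2) / 2 = n - 1 := by omega
      have e2 : ((M i j : ℤ) - 1) / 2 = n - 1 := by omega
      have hz : Real.sin (((((n : ℤ) - 1 : ℤ) : ℝ) + 1) * (2 * θ)) = 0 := by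
        have : ((((n : ℤ) - 1 : ℤ) : ℝ) + 1) * (2 * θ) = Real.pi := by
          rw [← hmθ, hn]; push_cast; ring
        rw [this, Real.sin_pi]
      rw [e1, e2, hz]
      simp
    · have e1 : ((M i j : ℤ) - 2) / 2 = n - 1 := by omega
      have e2 : ((M i j : ℤ) - 1) / 2 = n := by omega
      have e3 : ((M i j : ℤ) - 3) / 2 = n - 1 := by omega
      have e4 : ((M i j : ℤ)) / 2 = n := by omega
      have hz : Real.sin ((((n : ℤ) : ℝ) + 1) * (2 * θ)) =
          - Real.sin (((((n : ℤ) - 1 : ℤ) : ℝ) + 1) * (2 * θ)) := by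
        have h1 : (((n : ℤ) : ℝ) + 1) * (2 * θ) =
            (2 * Real.pi - ((((n : ℤ) - 1 : ℤ) : ℝ) + 1) * (2 * θ)) := by
          rw [← hmθ, hn]; push_cast; ring
        rw [h1, Real.sin_two_pi_sub]
      rw [e1, e2, e3, e4, hz]
      simp only [neg_div, neg_add_cancel, mul_zero, zero_smul, add_zero]
      simp

end CoxeterMatrix

namespace CoxeterSystem

variable {B W : Type*} [Group W] {M : CoxeterMatrix B} (cs : CoxeterSystem M W)

/-- The dual of the geometric representation. -/
noncomputable def dualRep : W →* ((B → ℝ) ≃ₗ[ℝ] (B → ℝ)) :=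
  cs.lift ⟨M.dualReflection, M.isLiftable_dualReflection⟩

theorem dualRep_simple (i : B) : cs.dualRep (cs.simple i) = M.dualReflection i :=
  cs.lift_apply_simple M.isLiftable_dualReflection i

/-- In the plane of the coordinates `i`, `j`, the product of the two reflections is the rotation
by `2π / m`. -/
theorem dualRep_simple_mul_simple_pow_sin (i j : B) (n : ℕ)
    (v : B → ℝ) (u : ℝ) (hi : v i = Real.sin u) (hj : v j = Real.sin (Real.pi / M i j - u)) :
    cs.dualRep ((cs.simple i * cs.simple j) ^ n) v i = Real.sin (u - n * (2 * (Real.pi / M i j))) ∧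
    cs.dualRep ((cs.simple i * cs.simple j) ^ n) v j =
      Real.sin (Real.pi / M i j - (u - n * (2 * (Real.pi / M i j)))) := by
  induction n with
  | zero => simp [hi, hj]
  | succ n ih =>
    rw [pow_succ', map_mul, map_mul, dualRep_simple, dualRep_simple]
    simp only [LinearEquiv.mul_apply, M.dualReflection_apply, M.cartan_self, ih.1, ih.2]
    rw [M.cartan_comm j i, CoxeterMatrix.cartan]
    generalize Real.pi / M i j = θ
    have hu : u - ((n + 1 : ℕ) : ℝ) * (2 * θ) = (u - n * (2 * θ)) - 2 * θ := by push_cast; ring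
    rw [hu]
    generalize u - n * (2 * θ) = w
    have e1 : θ - (w - 2 * θ) = 3 * θ - w := by ring
    rw [e1, Real.sin_sub θ, Real.sin_sub w, Real.sin_sub (3 * θ), Real.sin_three_mul,
      Real.cos_three_mul, Real.sin_two_mul, Real.cos_two_mul]
    have hs := Real.sin_sq_add_cos_sq θ
    have hs' : Real.sin θ ^ 2 = 1 - Real.cos θ ^ 2 := by linarith
    constructor
    · ring_nf
    · have : Real.sin θ ^ 3 = Real.sin θ * (1 - Real.cos θ ^ 2) := by rw [← hs']; ring
      rw [this]
      ring_nf

/-- When `m = ∞`, the product of the two reflections is unipotent on the plane of the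
coordinates `i`, `j`. -/
theorem dualRep_simple_mul_simple_pow_affine {i j : B} (h0 : M i j = 0) (n : ℕ)
    (v : B → ℝ) (hi : v i = 0) (hj : v j = 1) :
    cs.dualRep ((cs.simple i * cs.simple j) ^ n) v i = -2 * n ∧
    cs.dualRep ((cs.simple i * cs.simple j) ^ n) v j = 1 + 2 * n := by
  induction n with
  | zero => simp [hi, hj]
  | succ n ih =>
    rw [pow_succ', map_mul, map_mul, dualRep_simple, dualRep_simple]
    simp only [LinearEquiv.mul_apply, M.dualReflection_apply, M.cartan_self, ih.1, ih.2]
    rw [M.cartan_comm j i, CoxeterMatrix.cartan, h0]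
    push_cast
    simp only [div_zero, Real.cos_zero]
    constructor <;> ring

/-- The product of two simple reflections has exactly the order prescribed by the Coxeter
matrix. -/
theorem orderOf_simple_mul_simple (i j : B) : orderOf (cs.simple i * cs.simple j) = M i j := by
  classical
  refine Nat.dvd_antisymm (orderOf_dvd_of_pow_eq_one (cs.simple_mul_simple_pow i j)) ?_
  by_cases hij : i = j
  · subst hij; simp
  set n := orderOf (cs.simple i * cs.simple j) with hn
  have hp : (cs.simple i * cs.simple j) ^ n = 1 := pow_orderOf_eq_one _
  rcases eq_or_ne (M i j) 0 with h0 | h0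
  · have h := (cs.dualRep_simple_mul_simple_pow_affine h0 n (Function.update 0 j 1)
      (by simp [hij]) (by simp)).2
    rw [hp] at h
    have : n = 0 := by simpa using h
    simp [this]
  · have hm1 : M i j ≠ 1 := M.off_diagonal i j hij
    have hmR : (0 : ℝ) < M i j := by exact_mod_cast Nat.pos_of_ne_zero h0
    set θ : ℝ := Real.pi / M i j with hθ
    have hmθ : M i j * θ = Real.pi := by rw [hθ]; field_simp
    have h := cs.dualRep_simple_mul_simple_pow_sin i j n
      (Function.update 0 j (Real.sin θ)) 0 (by simp [hij]) (by simp [hθ])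
    have hpi := Real.pi_pos
    have hsθ : 0 < Real.sin θ := by
      apply Real.sin_pos_of_pos_of_lt_pi (by positivity)
      rw [hθ]
      apply div_lt_self hpi
      exact_mod_cast (by omega : 1 < M i j)
    rw [hp] at h
    simp only [map_one, LinearEquiv.coe_one, id_eq, Function.update_self,
      Function.update_of_ne hij, Pi.zero_apply, zero_sub, ← hθ] at h
    obtain ⟨h1, h2⟩ := h
    have hs : Real.sin (n * (2 * θ)) = 0 := by rw [Real.sin_neg] at h1; linarith
    have hc : Real.cos (n * (2 * θ)) = 1 := by
      rw [sub_neg_eq_add, Real.sin_add, hs, mul_zero, add_zero] at h2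
      exact (mul_left_cancel₀ hsθ.ne' (by linarith))
    obtain ⟨k, hk⟩ := (Real.cos_eq_one_iff _).1 hc
    have hk2 : (n : ℝ) = k * M i j := by
      have h3 : (k : ℝ) * (2 * (M i j * θ)) = n * (2 * θ) := by rw [hmθ]; exact hk
      have hθp : 0 < θ := by positivity
      have h4 : ((n : ℝ) - k * M i j) * (2 * θ) = 0 := by linarith
      rcases mul_eq_zero.1 h4 with h5 | h5
      · linarith
      · linarith
    have hk3 : (n : ℤ) = k * M i j := by exact_mod_cast hk2
    exact Int.natCast_dvd_natCast.1 ⟨k, by rw [hk3]; ring⟩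

theorem ne_zero_of_finite (cs : CoxeterSystem M W) [Finite W] (i j : B) : M i j ≠ 0 := by
  rw [← cs.orderOf_simple_mul_simple i j]
  exact (orderOf_pos _).ne'

end CoxeterSystem

/-! ### Alternating words and common descents -/

namespace CoxeterSystem

/-- The alternating word `s t s ⋯` of length `k` whose first letter is `s`. -/
def altList {S : Type*} (s t : S) : ℕ → List S
  | 0 => []
  | k + 1 => s :: altList t s k

section altList

variable {S : Type*} (s t : S)

theorem length_altList (k : ℕ) : (altList s t k).length = k := by
  induction k generalizing s t with
  | zero => rfl
  | succ k ih => simp [altList, ih]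

theorem altList_succ_append (k : ℕ) :
    altList s t (k + 1) = altList s t k ++ [if Even k then s else t] := by
  induction k generalizing s t with
  | zero => simp [altList]
  | succ k ih =>
    rw [altList, ih t s]
    conv_rhs => rw [altList]
    by_cases h : Even k <;> simp [h, parity_simps]

theorem reverse_altList (k : ℕ) :
    (altList s t k).reverse = if Even k then altList t s k else altList s t k := by
  induction k with
  | zero => simp [altList]
  | succ k ih =>
    rw [altList_succ_append, List.reverse_append, ih]
    by_cases h : Even k
    · have h' : ¬ Even (k + 1) := by simp [h, parity_simps]
      have e := altList_succ_append s t k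
      rw [if_pos h] at e
      rw [if_pos h, if_pos h, if_neg h', ← e]
      rfl
    · have h' : Even (k + 1) := by simp [h, parity_simps]
      rw [if_neg h, if_neg h, if_pos h', altList]; rfl

theorem alternatingWord_eq_altList (k : ℕ) :
    alternatingWord s t k = if Even k then altList s t k else altList t s k := by
  induction k with
  | zero => simp [altList, alternatingWord]
  | succ k ih =>
    rw [alternatingWord_succ', ih]
    by_cases h : Even k
    · have h' : ¬ Even (k + 1) := by simp [h, parity_simps]
      rw [if_pos h, if_pos h, if_neg h', altList]
    · have h' : Even (k + 1) := by simp [h, parity_simps]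
      rw [if_neg h, if_neg h, if_pos h', altList]

end altList

variable {B W : Type*} [Group W] {M : CoxeterMatrix B} (cs : CoxeterSystem M W)

theorem wordProd_altList_comm (i j : B) :
    cs.wordProd (altList i j (M i j)) = cs.wordProd (altList j i (M i j)) := by
  have h := cs.wordProd_braidWord_eq i j
  rw [braidWord, braidWord, M.symmetric j i, alternatingWord_eq_altList,
    alternatingWord_eq_altList] at h
  split_ifs at h
  · exact h
  · exact h.symm

/-- The reflections that shorten an alternating word are the obvious ones, those of its left
inversion sequence. -/
theorem eq_of_length_mul_altList_lt (i j : B) (n : ℕ) {r : W} (hr : cs.IsReflection r)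
    (h : cs.length (r * cs.wordProd (altList i j n)) < cs.length (cs.wordProd (altList i j n))) :
    ∃ k < n, r = cs.simple i * (cs.simple j * cs.simple i) ^ k := by
  induction n generalizing i j r with
  | zero => simp [altList] at h
  | succ n ih =>
    rw [altList, wordProd_cons] at h
    rcases hr.exchange _ h with h | h
    · refine ⟨0, n.succ_pos, ?_⟩
      rw [length_simple, Nat.lt_one_iff, length_eq_zero_iff] at h
      rw [pow_zero, mul_one, ← cs.inv_simple i]
      exact eq_inv_of_mul_eq_one_left h
    · have hr' : cs.IsReflection ((cs.simple i)⁻¹ * r * cs.simple i) := by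
        simpa using hr.conj (cs.simple i)
      obtain ⟨k, hk, e⟩ := ih j i hr' h
      refine ⟨k + 1, by omega, ?_⟩
      have e1 : r = cs.simple i * ((cs.simple i)⁻¹ * r * cs.simple i) * (cs.simple i)⁻¹ := by group
      rw [e1, e, inv_simple, ← mul_pow_mul, pow_succ]
      simp only [mul_assoc]

/-- Extending an alternating word on the left makes it longer, as long as it is shorter than the
braid relation. This is where the exact order of `s i * s j` is used. -/
theorem not_isLeftDescent_altList {i j : B} {n : ℕ} (hn : n < M i j) :
    ¬ cs.IsLeftDescent (cs.wordProd (altList j i n)) i := by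
  intro h
  obtain ⟨k, hk, e⟩ := cs.eq_of_length_mul_altList_lt j i n (cs.isReflection_simple i) h
  have h1 : (cs.simple i * cs.simple j) ^ (k + 1) = 1 := by
    have h2 : (cs.simple i * cs.simple j) ^ (k + 1) =
        cs.simple i * (cs.simple j * (cs.simple i * cs.simple j) ^ k) := by
      rw [pow_succ', mul_assoc]
    rw [h2, ← e, simple_mul_simple_self]
  have := Nat.le_of_dvd (by omega) (orderOf_dvd_of_pow_eq_one h1)
  rw [orderOf_simple_mul_simple] at this
  omega

theorem length_wordProd_altList {i j : B} {n : ℕ} (hn : n ≤ M i j) :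
    cs.length (cs.wordProd (altList i j n)) = n := by
  induction n generalizing i j with
  | zero => simp [altList]
  | succ n ih =>
    have h := (cs.not_isLeftDescent_iff).1 (cs.not_isLeftDescent_altList (i := i) (j := j) hn)
    rw [altList, wordProd_cons, h, ih (by rw [M.symmetric]; omega)]

/-- The elements of a dihedral parabolic subgroup are the alternating words of length at most
the order of the braid relation. -/
theorem exists_altList_of_mem_closure {i j : B} (h0 : M i j ≠ 0) {x : W}
    (hx : x ∈ Subgroup.closure {cs.simple i, cs.simple j}) :
    ∃ k ≤ M i j, x = cs.wordProd (altList i j k) ∨ x = cs.wordProd (altList j i k) := by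
  have step : ∀ i j : B, M i j ≠ 0 → ∀ x k, k ≤ M i j →
      (x = cs.wordProd (altList i j k) ∨ x = cs.wordProd (altList j i k)) →
      ∃ k ≤ M i j, cs.simple i * x = cs.wordProd (altList i j k) ∨
        cs.simple i * x = cs.wordProd (altList j i k) := by
    intro i j h0 x k hk hx
    have main : ∀ k, k ≤ M i j → x = cs.wordProd (altList i j k) →
      ∃ k ≤ M i j, cs.simple i * x = cs.wordProd (altList i j k) ∨
        cs.simple i * x = cs.wordProd (altList j i k) := by
      rintro (_ | k) hk rfl
      · exact ⟨1, by omega, Or.inl (by simp [altList])⟩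
      · exact ⟨k, by omega, Or.inr (by simp [altList, wordProd_cons])⟩
    rcases hx with hx | hx
    · exact main k hk hx
    · rcases hk.lt_or_eq with hk | rfl
      · exact ⟨k + 1, hk, Or.inl (by rw [hx, altList, wordProd_cons])⟩
      · exact main _ le_rfl (by rw [hx, wordProd_altList_comm])
  induction hx using Subgroup.closure_induction_left with
  | one => exact ⟨0, Nat.zero_le _, Or.inl (by simp [altList])⟩
  | mul_left y hy x hx ih =>
    obtain ⟨k, hk, e⟩ := ih
    rcases hy with rfl | rfl
    · exact step i j h0 x k hk e
    · rw [M.symmetric i j] at h0 hk ⊢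
      obtain ⟨k, hk, e⟩ := step j i h0 x k hk e.symm
      exact ⟨k, hk, e.symm⟩
  | inv_mul_cancel y hy x hx ih =>
    obtain ⟨k, hk, e⟩ := ih
    rcases hy with rfl | rfl
    · rw [inv_simple]; exact step i j h0 x k hk e
    · rw [inv_simple]
      rw [M.symmetric i j] at h0 hk ⊢
      obtain ⟨k, hk, e⟩ := step j i h0 x k hk e.symm
      exact ⟨k, hk, e.symm⟩

/-- An element with two distinct left descents `i`, `j` has the braid word on `i`, `j` as a
reduced left factor. -/
theorem exists_wordProd_altList_mul {i j : B} (h0 : M i j ≠ 0) {v : W}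
    (hi : cs.IsLeftDescent v i) (hj : cs.IsLeftDescent v j) :
    ∃ v', v = cs.wordProd (altList i j (M i j)) * v' ∧ cs.length v = M i j + cs.length v' := by
  classical
  set H := Subgroup.closure {cs.simple i, cs.simple j} with hH
  have hiH : cs.simple i ∈ H := Subgroup.subset_closure (by simp)
  have hjH : cs.simple j ∈ H := Subgroup.subset_closure (by simp)
  -- `d` is an element of minimal length in the coset `H v`
  obtain ⟨d, ⟨y, hyH, hy⟩, hmin⟩ : ∃ d, (∃ y ∈ H, y * d = v) ∧
      ∀ d', (∃ y ∈ H, y * d' = v) → cs.length d ≤ cs.length d' := by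
    have hne : {d | ∃ y ∈ H, y * d = v}.Nonempty := ⟨v, 1, H.one_mem, one_mul v⟩
    exact ⟨Function.argminOn cs.length _ hne, Function.argminOn_mem cs.length _ hne,
      fun d' hd' => Function.argminOn_le cs.length _ hd'⟩
  have hred : ∀ (k : ℕ) (a b : B), a ∈ ({i, j} : Set B) → b ∈ ({i, j} : Set B) →
      k ≤ M a b → (cs.wordProd (altList a b k) ∈ H ∧
      cs.length (cs.wordProd (altList a b k) * d) = k + cs.length d) := by
    intro k
    have hmem : ∀ a ∈ ({i, j} : Set B), cs.simple a ∈ H := by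
      rintro a (rfl | rfl)
      · exact hiH
      · exact hjH
    induction k with
    | zero => intro a b _ _ _; simp [altList, H.one_mem]
    | succ k ih =>
      intro a b ha hb hk
      obtain ⟨hxH, hx⟩ := ih b a hb ha (by rw [M.symmetric]; omega)
      refine ⟨by rw [altList, wordProd_cons]; exact H.mul_mem (hmem a ha) hxH, ?_⟩
      rw [altList, wordProd_cons, mul_assoc]
      rcases cs.length_simple_mul_lt_or a (cs.wordProd (altList b a k) * d) with h | h
      · exfalso
        rcases (cs.isReflection_simple a).exchange _ h with h | h
        · exact cs.not_isLeftDescent_altList (by omega) h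
        · set x := cs.wordProd (altList b a k)
          have hz : x⁻¹ * cs.simple a * x ∈ H :=
            H.mul_mem (H.mul_mem (H.inv_mem hxH) (hmem a ha)) hxH
          refine absurd h (not_lt.2 (hmin _ ⟨y * (x⁻¹ * cs.simple a * x)⁻¹,
            H.mul_mem hyH (H.inv_mem hz), ?_⟩))
          rw [← hy]; group
      · rw [h, hx]; omega
  have key : ∀ a b : B, a ∈ ({i, j} : Set B) → b ∈ ({i, j} : Set B) → ∀ k, k ≤ M a b →
      y = cs.wordProd (altList a b k) → cs.IsLeftDescent v b → k = M a b := by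
    intro a b ha hb k hk e hbv
    by_contra hne
    have h1 := (hred k a b ha hb hk).2
    have h2 := (hred (k + 1) b a hb ha (by rw [M.symmetric]; omega)).2
    rw [altList, wordProd_cons, mul_assoc, ← e, hy] at h2
    rw [← e, hy] at h1
    unfold IsLeftDescent at hbv
    omega
  obtain ⟨k, hk, e | e⟩ := cs.exists_altList_of_mem_closure h0 hyH
  · have := key i j (by simp) (by simp) k hk e hj
    subst this
    refine ⟨d, by rw [← e, hy], ?_⟩
    rw [← hy, e, (hred _ i j (by simp) (by simp) le_rfl).2]
  · have := key j i (by simp) (by simp) k (by rwa [M.symmetric]) e hi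
    rw [M.symmetric] at this
    subst this
    rw [← wordProd_altList_comm] at e
    refine ⟨d, by rw [← e, hy], ?_⟩
    rw [← hy, e, (hred _ i j (by simp) (by simp) le_rfl).2]

end CoxeterSystem

/-! ### The Artin monoid -/

namespace ArtinTits

open CoxeterSystem

variable {S : Type*} (M : CoxeterMatrix S)

/-- The braid relations `s t s ⋯ = t s t ⋯`, with `m_{s,t}` letters on each side. -/
def monoidRels (a b : FreeMonoid S) : Prop :=
  ∃ s t : S, s ≠ t ∧ M s t ≠ 0 ∧ a = FreeMonoid.ofList (altList s t (M s t)) ∧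
    b = FreeMonoid.ofList (altList t s (M s t))

/-- The Artin–Tits monoid, given by the presentation of the Artin–Tits group. Its divisibility
relation `∣` is left divisibility. -/
abbrev ArtinMonoid : Type _ := PresentedMonoid (monoidRels M)

/-- The generator of the Artin–Tits monoid attached to `s`. -/
def atom (s : S) : ArtinMonoid M := PresentedMonoid.of _ s

/-- The class of the alternating word `s t s ⋯` with `k` letters. -/
def alt (s t : S) (k : ℕ) : ArtinMonoid M :=
  PresentedMonoid.mk _ (FreeMonoid.ofList (altList s t k))

@[simp] theorem alt_zero (s t : S) : alt M s t 0 = 1 := rfl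

theorem alt_succ (s t : S) (k : ℕ) : alt M s t (k + 1) = atom M s * alt M t s k := rfl

theorem alt_eq (s t : S) {k : ℕ} (hk : k ≠ 0) : alt M s t k = atom M s * alt M t s (k - 1) := by
  obtain ⟨k, rfl⟩ := Nat.exists_eq_succ_of_ne_zero hk
  exact alt_succ M s t k

theorem alt_comm {s t : S} (hst : s ≠ t) (h0 : M s t ≠ 0) :
    alt M s t (M s t) = alt M t s (M s t) :=
  PresentedMonoid.mk_eq_mk_of_rel ⟨s, t, hst, h0, rfl, rfl⟩

variable {M}

theorem exists_atom_mul {x : ArtinMonoid M} (hx : x ≠ 1) : ∃ s y, x = atom M s * y := by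
  obtain ⟨w, rfl⟩ := PresentedMonoid.surjective_mk x
  cases w using FreeMonoid.casesOn with
  | one => exact absurd (map_one _) hx
  | of_mul s w => exact ⟨s, PresentedMonoid.mk _ w, by rw [map_mul]; rfl⟩

theorem exists_mul_atom {x : ArtinMonoid M} (hx : x ≠ 1) : ∃ s y, x = y * atom M s := by
  obtain ⟨w, rfl⟩ := PresentedMonoid.surjective_mk x
  induction w using FreeMonoid.inductionOn' with
  | one => exact absurd (map_one _) hx
  | of_mul s w ih =>
    by_cases hw : PresentedMonoid.mk (monoidRels M) w = 1
    · exact ⟨s, 1, by rw [map_mul, hw, mul_one, one_mul]; rfl⟩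
    · obtain ⟨t, y, hy⟩ := ih hw
      exact ⟨t, PresentedMonoid.mk (monoidRels M) (FreeMonoid.of s) * y,
        by rw [map_mul, hy, mul_assoc]⟩

@[elab_as_elim]
theorem atom_induction {p : ArtinMonoid M → Prop} (x : ArtinMonoid M) (one : p 1)
    (atom_mul : ∀ s y, p y → p (atom M s * y)) : p x := by
  obtain ⟨w, rfl⟩ := PresentedMonoid.surjective_mk x
  induction w using FreeMonoid.inductionOn' with
  | one => exact one
  | of_mul s w ih => rw [map_mul]; exact atom_mul s _ ih

theorem lift_ofList {G : Type*} [Monoid G] (f : S → G) (l : List S) :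
    FreeMonoid.lift f (FreeMonoid.ofList l) = (l.map f).prod := by
  rw [FreeMonoid.lift_apply]; rfl

/-! ### Length and the projection to the Coxeter group -/

/-- The length homomorphism of the Artin–Tits monoid. -/
def lenHom (M : CoxeterMatrix S) : ArtinMonoid M →* Multiplicative ℕ :=
  PresentedMonoid.lift (fun _ => Multiplicative.ofAdd 1) (by
    rintro a b ⟨s, t, -, -, rfl, rfl⟩
    rw [lift_ofList, lift_ofList]
    simp [length_altList])

/-- The length of an element of the Artin–Tits monoid. -/
def len (x : ArtinMonoid M) : ℕ := (lenHom M x).toAdd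

@[simp] theorem len_one : len (1 : ArtinMonoid M) = 0 := by simp [len]

@[simp] theorem len_mul (x y : ArtinMonoid M) : len (x * y) = len x + len y := by simp [len]

@[simp] theorem len_atom (s : S) : len (atom M s) = 1 := rfl

@[simp] theorem len_alt (s t : S) (k : ℕ) : len (alt M s t k) = k := by
  induction k generalizing s t with
  | zero => simp
  | succ k ih => rw [alt_succ]; simp [ih, add_comm]

theorem len_eq_zero {x : ArtinMonoid M} : len x = 0 ↔ x = 1 := by
  refine ⟨fun h => ?_, by rintro rfl; simp⟩
  by_contra hx
  obtain ⟨s, y, rfl⟩ := exists_atom_mul hx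
  simp at h

theorem exists_eq_atom {x : ArtinMonoid M} (h : len x = 1) : ∃ s, x = atom M s := by
  obtain ⟨s, y, rfl⟩ := exists_atom_mul (x := x) (by rintro rfl; simp at h)
  have : y = 1 := len_eq_zero.1 (by simpa using h)
  exact ⟨s, by rw [this, mul_one]⟩

/-- The projection of the Artin–Tits monoid to the Coxeter group. -/
def proj (M : CoxeterMatrix S) : ArtinMonoid M →* M.Group :=
  PresentedMonoid.lift M.toCoxeterSystem.simple (by
    rintro a b ⟨s, t, -, -, rfl, rfl⟩
    rw [lift_ofList, lift_ofList]
    exact M.toCoxeterSystem.wordProd_altList_comm s t)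

local notation "cs" => CoxeterMatrix.toCoxeterSystem

@[simp] theorem proj_atom (s : S) : proj M (atom M s) = (cs M).simple s := rfl

theorem proj_mk (l : List S) :
    proj M (PresentedMonoid.mk _ (FreeMonoid.ofList l)) = (cs M).wordProd l :=
  lift_ofList _ l

theorem proj_alt (s t : S) (k : ℕ) : proj M (alt M s t k) = (cs M).wordProd (altList s t k) :=
  proj_mk _

theorem len_mk (l : List S) :
    len (PresentedMonoid.mk (monoidRels M) (FreeMonoid.ofList l)) = l.length := by
  induction l with
  | nil => exact len_one
  | cons s l ih =>
    rw [FreeMonoid.ofList_cons, map_mul, len_mul, ih, add_comm]; rfl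

theorem length_proj_le (x : ArtinMonoid M) : (cs M).length (proj M x) ≤ len x := by
  induction x using atom_induction with
  | one => simp
  | atom_mul s y ih =>
    rw [map_mul, len_mul, len_atom]
    refine ((cs M).length_mul_le _ _).trans ?_
    rw [proj_atom, length_simple]
    omega

/-- An element of the Artin–Tits monoid is simple if its words are reduced words of the
Coxeter group. -/
def IsSimple (x : ArtinMonoid M) : Prop := (cs M).length (proj M x) = len x

theorem IsSimple.left {x y : ArtinMonoid M} (h : IsSimple (x * y)) : IsSimple x := by
  have h1 := (cs M).length_mul_le (proj M x) (proj M y)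
  have h2 := length_proj_le x
  have h3 := length_proj_le y
  unfold IsSimple at *
  rw [map_mul, len_mul] at h
  omega

theorem IsSimple.right {x y : ArtinMonoid M} (h : IsSimple (x * y)) : IsSimple y := by
  have h1 := (cs M).length_mul_le (proj M x) (proj M y)
  have h2 := length_proj_le x
  have h3 := length_proj_le y
  unfold IsSimple at *
  rw [map_mul, len_mul] at h
  omega

theorem not_isSimple_atom_mul_self (s : S) : ¬ IsSimple (atom M s * atom M s) := by
  intro h
  rw [IsSimple, map_mul, proj_atom, simple_mul_simple_self, length_one] at h
  simp at h

theorem isSimple_alt {s t : S} {k : ℕ} (hk : k ≤ M s t) : IsSimple (alt M s t k) := by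
  rw [IsSimple, proj_alt, len_alt, length_wordProd_altList _ hk]

theorem exists_isSimple_proj_eq (w : M.Group) : ∃ x : ArtinMonoid M, IsSimple x ∧ proj M x = w := by
  obtain ⟨l, hl, rfl⟩ := (cs M).exists_isReduced w
  refine ⟨PresentedMonoid.mk _ (FreeMonoid.ofList l), ?_, proj_mk l⟩
  rw [IsSimple, proj_mk, len_mk, hl]

/-- Matsumoto's theorem: a simple element is determined by its image in the Coxeter group. -/
theorem IsSimple.eq_of_proj_eq [Finite M.Group] {x y : ArtinMonoid M} (hx : IsSimple x)
    (hy : IsSimple y) (h : proj M x = proj M y) : x = y := by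
  obtain ⟨n, hn⟩ : ∃ n, len x = n := ⟨_, rfl⟩
  induction n generalizing x y with
  | zero =>
    have : len y = 0 := by rw [← hy, ← h, hx, hn]
    rw [len_eq_zero.1 hn, len_eq_zero.1 this]
  | succ n ih =>
    have hxy : len y = len x := by rw [← hy, ← h, hx]
    obtain ⟨s, x, rfl⟩ := exists_atom_mul (x := x) (by rintro rfl; simp at hn)
    obtain ⟨t, y, rfl⟩ := exists_atom_mul (x := y) (by rintro rfl; simp at hxy; omega)
    have hlx : len x = n := by simp at hn; omega
    have hly : len y = n := by simp at hn hxy; omega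
    by_cases hst : s = t
    · subst hst
      rw [ih hx.right hy.right (by simpa using h) hlx]
    · have h0 : M s t ≠ 0 := ne_zero_of_finite (cs M) s t
      have hs : (cs M).IsLeftDescent (proj M (atom M s * x)) s := by
        rw [IsLeftDescent, hx, map_mul, proj_atom, simple_mul_simple_cancel_left, hx.right]
        simp
      have ht : (cs M).IsLeftDescent (proj M (atom M s * x)) t := by
        rw [h, IsLeftDescent, hy, map_mul, proj_atom, simple_mul_simple_cancel_left, hy.right]
        simp
      obtain ⟨v, hv, hlv⟩ := (cs M).exists_wordProd_altList_mul h0 hs ht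
      obtain ⟨z, hz, rfl⟩ := exists_isSimple_proj_eq v
      rw [hz, hx] at hlv
      rw [← proj_alt, ← map_mul] at hv
      have hsz : IsSimple (alt M s t (M s t) * z) := by
        rw [IsSimple, ← hv, hx, hlv]; simp
      have e1 : alt M s t (M s t) * z = atom M s * (alt M t s (M s t - 1) * z) := by
        rw [alt_eq M s t h0, mul_assoc]
      have e2 : alt M s t (M s t) * z = atom M t * (alt M s t (M s t - 1) * z) := by
        rw [alt_comm M hst h0, alt_eq M t s h0, mul_assoc]
      have hx2 : x = alt M t s (M s t - 1) * z := by
        refine ih hx.right (e1 ▸ hsz).right ?_ hlx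
        have := hv
        rw [e1, map_mul, map_mul] at this
        exact mul_left_cancel this
      have hy2 : y = alt M s t (M s t - 1) * z := by
        refine ih hy.right (e2 ▸ hsz).right ?_ hly
        have := h.symm.trans hv
        rw [e2, map_mul, map_mul] at this
        exact mul_left_cancel this
      rw [hx2, hy2, ← e1, ← e2]

/-! ### Local least common multiples -/

/-- The conclusion about an equality `s a = t b` of the local lcm property: either `s = t` and
`a = b`, or both sides are a multiple of the braid word on `s` and `t`. -/
def Completes (s : S) (a : ArtinMonoid M) (t : S) (b : ArtinMonoid M) : Prop :=
  (s = t → a = b) ∧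
    (s ≠ t → ∃ c, a = alt M t s (M s t - 1) * c ∧ b = alt M s t (M s t - 1) * c)

/-- The local lcm property (including left cancellation) for elements of length at most `n`. -/
def LocalLcm (M : CoxeterMatrix S) (n : ℕ) : Prop :=
  ∀ (s t : S) (a b : ArtinMonoid M), atom M s * a = atom M t * b → len (atom M s * a) ≤ n →
    Completes s a t b

theorem Completes.symm {s t : S} {a b : ArtinMonoid M} (h : Completes s a t b) :
    Completes t b s a := by
  refine ⟨fun e => (h.1 e.symm).symm, fun e => ?_⟩
  obtain ⟨c, h1, h2⟩ := h.2 (Ne.symm e)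
  exact ⟨c, by rw [M.symmetric t s]; exact h2, by rw [M.symmetric t s]; exact h1⟩

theorem Completes.mul_right {s t : S} {a b : ArtinMonoid M} (h : Completes s a t b)
    (d : ArtinMonoid M) : Completes s (a * d) t (b * d) := by
  refine ⟨fun e => by rw [h.1 e], fun e => ?_⟩
  obtain ⟨c, h1, h2⟩ := h.2 e
  exact ⟨c * d, by rw [h1, mul_assoc], by rw [h2, mul_assoc]⟩

theorem LocalLcm.cancel {n : ℕ} (hn : LocalLcm M n) {x a b : ArtinMonoid M}
    (h : x * a = x * b) (hl : len (x * a) ≤ n) : a = b := by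
  induction x using atom_induction with
  | one => simpa using h
  | atom_mul s y ih =>
    rw [mul_assoc, mul_assoc] at h
    rw [mul_assoc] at hl
    refine ih ((hn s s _ _ h hl).1 rfl) ?_
    simp at hl ⊢
    omega

/-- Among left divisors, a set `D` that is closed under left divisors and under local lcms is
directed: two elements of `D` dividing `e` have a common multiple in `D` dividing `e`. -/
theorem LocalLcm.directed [Finite M.Group] {n : ℕ} (hn : LocalLcm M n) {e : ArtinMonoid M}
    (he : len e ≤ n) {D : Set (ArtinMonoid M)} (hD : ∀ x y, x * y ∈ D → x ∈ D)
    (hD' : ∀ a s t, s ≠ t → a * atom M s ∈ D → a * atom M t ∈ D → a * alt M s t (M s t) ∈ D)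
    {x y : ArtinMonoid M} (hx : x ∈ D) (hy : y ∈ D) (hxe : x ∣ e) (hye : y ∣ e) :
    ∃ z ∈ D, x ∣ z ∧ y ∣ z ∧ z ∣ e := by
  obtain ⟨k, hk⟩ : ∃ k, len e = k := ⟨_, rfl⟩
  induction k generalizing e D x y with
  | zero =>
    rw [len_eq_zero.1 hk] at hxe hye
    have key : ∀ x : ArtinMonoid M, x ∣ 1 → x = 1 := by
      rintro x ⟨c, hc⟩
      have := congrArg len hc
      simp at this
      exact len_eq_zero.1 (by omega)
    rw [key x hxe] at hx ⊢
    rw [key y hye]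
    exact ⟨1, hx, dvd_rfl, dvd_rfl, one_dvd _⟩
  | succ k ih =>
    by_cases hx1 : x = 1
    · exact ⟨y, hy, hx1 ▸ one_dvd _, dvd_rfl, hye⟩
    by_cases hy1 : y = 1
    · exact ⟨x, hx, dvd_rfl, hy1 ▸ one_dvd _, hxe⟩
    -- the induction hypothesis, used after removing a first letter from everything
    have step : ∀ (s : S) (e' x' y' : ArtinMonoid M), e = atom M s * e' → atom M s * x' ∈ D →
        atom M s * y' ∈ D → x' ∣ e' → y' ∣ e' →
        ∃ z, atom M s * z ∈ D ∧ x' ∣ z ∧ y' ∣ z ∧ z ∣ e' := by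
      intro s e' x' y' h1 h2 h3 h4 h5
      have hl : len e' = k := by rw [h1] at hk; simp at hk; omega
      refine ih (e := e') (D := {a | atom M s * a ∈ D}) (by omega) ?_ ?_ h2 h3 h4 h5 hl
      · intro a b hab
        exact hD (atom M s * a) b (by rw [mul_assoc]; exact hab)
      · intro a u v huv hu hv
        have := hD' (atom M s * a) u v huv (by rw [mul_assoc]; exact hu)
          (by rw [mul_assoc]; exact hv)
        rwa [mul_assoc] at this
    obtain ⟨s, x, rfl⟩ := exists_atom_mul hx1
    obtain ⟨t, y, rfl⟩ := exists_atom_mul hy1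
    obtain ⟨f, hf⟩ := hxe
    obtain ⟨g, hg⟩ := hye
    rw [mul_assoc] at hf hg
    have hc := hn s t (x * f) (y * g) (hf.symm.trans hg) (hf ▸ he)
    by_cases hst : s = t
    · subst hst
      obtain ⟨z, h1, h2, h3, h4⟩ := step s (x * f) x y hf hx hy ⟨f, rfl⟩ ⟨g, hc.1 rfl⟩
      exact ⟨_, h1, mul_dvd_mul_left _ h2, mul_dvd_mul_left _ h3, hf ▸ mul_dvd_mul_left _ h4⟩
    · have h0 : M s t ≠ 0 := ne_zero_of_finite (cs M) s t
      obtain ⟨c, hc1, hc2⟩ := hc.2 hst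
      have hΔ : alt M s t (M s t) ∈ D := by
        simpa using hD' 1 s t hst (by simpa using hD _ _ hx) (by simpa using hD _ _ hy)
      have hΔs := hΔ
      have hΔt := hΔ
      rw [alt_eq M s t h0] at hΔs
      rw [alt_comm M hst h0, alt_eq M t s h0] at hΔt
      obtain ⟨z, h1, h2, h3, h4⟩ := step s (x * f) x _ hf hx hΔs ⟨f, rfl⟩ ⟨c, hc1⟩
      obtain ⟨z', h1', h2', h3', h4'⟩ := step t (y * g) y _ hg hy hΔt ⟨g, rfl⟩ ⟨c, hc2⟩
      -- both `s z` and `t z'` are multiples of the braid word, so both start with `s`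
      obtain ⟨p, rfl⟩ := h3'
      have e' : atom M t * (alt M s t (M s t - 1) * p) =
          atom M s * (alt M t s (M s t - 1) * p) := by
        rw [← mul_assoc, ← alt_eq M t s h0, ← alt_comm M hst h0, alt_eq M s t h0, mul_assoc]
      rw [e'] at h1'
      have h5 : alt M t s (M s t - 1) * p ∣ x * f := by
        obtain ⟨q, hq⟩ := h4'
        refine ⟨q, hn.cancel (x := atom M s) ?_ (hf ▸ he)⟩
        rw [← hf, hg, hq, ← mul_assoc, e', mul_assoc]
      obtain ⟨z'', k1, k2, k3, k4⟩ := step s (x * f) z _ hf h1 h1' h4 h5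
      refine ⟨_, k1, mul_dvd_mul_left _ (h2.trans k2), ?_, hf ▸ mul_dvd_mul_left _ k4⟩
      exact (mul_dvd_mul_left _ h2').trans (e' ▸ mul_dvd_mul_left _ k3)

/-- The elements of the monoid that are reduced left factors of `v`. -/
def reducedPrefixes (v : M.Group) : Set (ArtinMonoid M) :=
  {x | len x + (cs M).length ((proj M x)⁻¹ * v) = (cs M).length v}

theorem mem_reducedPrefixes_of_mul {v : M.Group} {x y : ArtinMonoid M}
    (h : x * y ∈ reducedPrefixes v) : x ∈ reducedPrefixes v := by
  simp only [reducedPrefixes, Set.mem_ofPred_eq, len_mul, map_mul, mul_inv_rev, mul_assoc] at h ⊢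
  have h1 := (cs M).length_mul_le (proj M x) ((proj M x)⁻¹ * v)
  have h2 := (cs M).length_mul_le (proj M y) ((proj M y)⁻¹ * ((proj M x)⁻¹ * v))
  rw [mul_inv_cancel_left] at h1 h2
  have h3 := length_proj_le x
  have h4 := length_proj_le y
  omega

theorem mul_alt_mem_reducedPrefixes [Finite M.Group] {v : M.Group} (a : ArtinMonoid M) (s t : S)
    (hs : a * atom M s ∈ reducedPrefixes v) (ht : a * atom M t ∈ reducedPrefixes v) :
    a * alt M s t (M s t) ∈ reducedPrefixes v := by
  have ha := mem_reducedPrefixes_of_mul hs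
  simp only [reducedPrefixes, Set.mem_ofPred_eq, len_mul, map_mul, mul_inv_rev, mul_assoc,
    len_atom, proj_atom, inv_simple, len_alt] at ha hs ht ⊢
  obtain ⟨v', h1, h2⟩ := (cs M).exists_wordProd_altList_mul (ne_zero_of_finite (cs M) s t)
    (v := (proj M a)⁻¹ * v) (i := s) (j := t) (by unfold IsLeftDescent; omega)
    (by unfold IsLeftDescent; omega)
  rw [h2] at ha
  rw [h1, proj_alt, inv_mul_cancel_left]
  omega

theorem exists_maximal_length (M : CoxeterMatrix S) [Finite M.Group] :
    ∃ w₀ : M.Group, ∀ v, (cs M).length v ≤ (cs M).length w₀ :=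
  Finite.exists_max _

/-- Transitivity of `Completes`. When the three letters are distinct, the element `e` is a
multiple of two braid words missing their first letter `u`; directedness among the prefixes of
`u w₀` produces a divisor `z` of `e` such that `u z` is simple, and the simple
element `u z` is a multiple of the braid word on `s` and `t` by Matsumoto's theorem. -/
theorem Completes.trans [Finite M.Group] {n : ℕ} (hn : LocalLcm M n) {s u t : S}
    {a e b : ArtinMonoid M} (h : Completes s a u e) (h' : Completes u e t b) (he : len e ≤ n) :
    Completes s a t b := by
  by_cases hsu : s = u
  · subst hsu; rwa [h.1 rfl]
  by_cases hut : u = t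
  · subst hut; rwa [← h'.1 rfl]
  obtain ⟨c, ha, hec⟩ := h.2 hsu
  obtain ⟨c', hec', hb⟩ := h'.2 hut
  by_cases hst : s = t
  · subst hst
    refine ⟨fun _ => ?_, fun e => absurd rfl e⟩
    rw [M.symmetric u s] at hec' hb
    have : c = c' := hn.cancel (hec.symm.trans hec') (hec ▸ he)
    rw [ha, hb, this]
  refine ⟨fun e => absurd e hst, fun _ => ?_⟩
  obtain ⟨w₀, hw₀⟩ := exists_maximal_length M
  have hlong := (cs M).length_add_of_maximal hw₀
  set v := (cs M).simple u * w₀ with hv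
  have hlv : 1 + (cs M).length v = (cs M).length w₀ := by
    have := hlong ((cs M).simple u)
    rwa [length_simple, inv_simple] at this
  have halt : ∀ r, u ≠ r → alt M r u (M u r - 1) ∈ reducedPrefixes v := by
    intro r hur
    have h0 : M u r ≠ 0 := ne_zero_of_finite (cs M) u r
    have h1 := hlong (proj M (alt M u r (M u r)))
    rw [isSimple_alt le_rfl, len_alt, alt_eq M u r h0, map_mul, mul_inv_rev, proj_atom,
      inv_simple, mul_assoc, ← hv] at h1
    simp only [reducedPrefixes, Set.mem_ofPred_eq, len_alt]
    omega
  have hsD := halt s (Ne.symm hsu)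
  rw [M.symmetric u s] at hsD
  obtain ⟨z, hz, ⟨p, hp⟩, ⟨q, hq⟩, ⟨f, hf⟩⟩ := hn.directed he
    (fun x y => mem_reducedPrefixes_of_mul)
    (fun a s t _ => mul_alt_mem_reducedPrefixes a s t) hsD (halt t hut) ⟨c, hec⟩ ⟨c', hec'⟩
  have hsimple : IsSimple (atom M u * z) := by
    have h1 := length_proj_le (atom M u * z)
    have h2 := (cs M).length_mul_le (proj M (atom M u * z)) ((proj M (atom M u * z))⁻¹ * w₀)
    rw [mul_inv_cancel_left] at h2
    have h3 : (proj M (atom M u * z))⁻¹ * w₀ = (proj M z)⁻¹ * v := by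
      rw [map_mul, mul_inv_rev, proj_atom, inv_simple, mul_assoc]
    rw [h3] at h2
    simp only [reducedPrefixes, Set.mem_ofPred_eq] at hz
    unfold IsSimple
    simp only [len_mul, len_atom] at h1 ⊢
    omega
  have h0su := ne_zero_of_finite (cs M) s u
  have h0ut := ne_zero_of_finite (cs M) u t
  have h0st := ne_zero_of_finite (cs M) s t
  have es : atom M u * z = atom M s * (alt M u s (M s u - 1) * p) := by
    rw [hp, ← mul_assoc, ← mul_assoc, ← alt_eq M s u h0su, alt_comm M hsu h0su,
      ← alt_eq M u s h0su]
  have et : atom M u * z = atom M t * (alt M u t (M u t - 1) * q) := by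
    rw [hq, ← mul_assoc, ← mul_assoc, ← alt_eq M u t h0ut, alt_comm M hut h0ut,
      ← alt_eq M t u h0ut]
  have hdesc : ∀ r x, atom M u * z = atom M r * x →
      (cs M).IsLeftDescent (proj M (atom M u * z)) r := by
    intro r x hx
    rw [IsLeftDescent, hsimple, hx, map_mul, proj_atom, simple_mul_simple_cancel_left,
      (show IsSimple (atom M r * x) from hx ▸ hsimple).right]
    simp
  obtain ⟨v', hv', hlv'⟩ := (cs M).exists_wordProd_altList_mul h0st (hdesc s _ es) (hdesc t _ et)
  obtain ⟨d, hd, rfl⟩ := exists_isSimple_proj_eq v'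
  rw [hsimple, hd] at hlv'
  rw [← proj_alt, ← map_mul] at hv'
  have hsd : IsSimple (alt M s t (M s t) * d) := by
    rw [IsSimple, ← hv', hsimple, hlv', len_mul, len_alt]
  have hz' : atom M u * z = alt M s t (M s t) * d := hsimple.eq_of_proj_eq hsd hv'
  have cancel : ∀ r x y, atom M u * z = atom M r * x → alt M s t (M s t) * d = atom M r * y →
      x = y := by
    intro r x y hx hy
    refine (hx ▸ hsimple).right.eq_of_proj_eq (hy ▸ hsd).right ?_
    have := congrArg (proj M) (hx.symm.trans (hz'.trans hy))
    rw [map_mul, map_mul] at this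
    exact mul_left_cancel this
  have e1 := cancel s _ (alt M t s (M s t - 1) * d) es (by rw [alt_eq M s t h0st, mul_assoc])
  have e2 := cancel t _ (alt M s t (M s t - 1) * d) et
    (by rw [alt_comm M hst h0st, alt_eq M t s h0st, mul_assoc])
  refine ⟨d * f, ?_, ?_⟩
  · have : c = p * f := by
      refine hn.cancel (x := alt M s u (M s u - 1)) ?_ (hec ▸ he)
      rw [← hec, hf, hp, mul_assoc]
    rw [ha, this, ← mul_assoc, e1, mul_assoc]
  · have : c' = q * f := by
      refine hn.cancel (x := alt M t u (M u t - 1)) ?_ (hec' ▸ he)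
      rw [← hec', hf, hq, mul_assoc]
    rw [hb, this, ← mul_assoc, e2, mul_assoc]

theorem completes_of_rel [Finite M.Group] {n : ℕ} (hn : LocalLcm M n) {w₁ w₂ : FreeMonoid S}
    (h : ConGen.Rel (monoidRels M) w₁ w₂)
    (hl : len (PresentedMonoid.mk (monoidRels M) w₁) ≤ n + 1) {s t : S} {a b : FreeMonoid S}
    (h1 : w₁ = FreeMonoid.of s * a) (h2 : w₂ = FreeMonoid.of t * b) :
    Completes s (PresentedMonoid.mk (monoidRels M) a) t (PresentedMonoid.mk (monoidRels M) b) := by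
  have inj : ∀ {s t : S} {a b : FreeMonoid S}, FreeMonoid.of s * a = FreeMonoid.of t * b →
      s = t ∧ a = b := fun h => List.cons.inj h
  have hmk : ∀ {w₁ w₂ : FreeMonoid S}, ConGen.Rel (monoidRels M) w₁ w₂ →
      PresentedMonoid.mk (monoidRels M) w₁ = PresentedMonoid.mk (monoidRels M) w₂ :=
    fun h => PresentedMonoid.mk_eq_mk_iff.2 h
  have hlen : ∀ (s : S) (a : FreeMonoid S),
      len (PresentedMonoid.mk (monoidRels M) (FreeMonoid.of s * a)) =
        1 + len (PresentedMonoid.mk (monoidRels M) a) := by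
    intro s a
    rw [map_mul, len_mul]; rfl
  induction h generalizing s t a b with
  | of x y hxy =>
    obtain ⟨s', t', hst, h0, rfl, rfl⟩ := hxy
    obtain ⟨m, hm⟩ := Nat.exists_eq_succ_of_ne_zero h0
    rw [hm] at h1 h2
    obtain ⟨rfl, rfl⟩ := inj (s := s') (a := FreeMonoid.ofList (altList t' s' m)) h1
    obtain ⟨rfl, rfl⟩ := inj (s := t') (a := FreeMonoid.ofList (altList s' t' m)) h2
    refine ⟨fun e => absurd e hst, fun _ => ⟨1, ?_, ?_⟩⟩
    · rw [mul_one, hm]; rfl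
    · rw [mul_one, hm]; rfl
  | refl x =>
    obtain ⟨rfl, rfl⟩ := inj (h1.symm.trans h2)
    exact ⟨fun _ => rfl, fun e => absurd rfl e⟩
  | symm h ih => exact (ih (by rwa [hmk h]) h2 h1).symm
  | @trans x y z hxy hyz ih1 ih2 =>
    have hly := hl
    rw [hmk hxy] at hly
    cases y using FreeMonoid.casesOn with
    | one =>
      have := congrArg len (hmk hxy)
      rw [h1, hlen, map_one, len_one] at this
      omega
    | of_mul u e =>
      refine (ih1 hl h1 rfl).trans hn (ih2 hly rfl h2) ?_
      rw [hlen] at hly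
      omega
  | @mul w x y z hwx hyz ih1 ih2 =>
    cases w using FreeMonoid.casesOn with
    | one =>
      cases x using FreeMonoid.casesOn with
      | one => exact ih2 (by simpa using hl) (by simpa using h1) (by simpa using h2)
      | of_mul u e =>
        have := congrArg len (hmk hwx)
        rw [hlen, map_one, len_one] at this
        omega
    | of_mul u e =>
      cases x using FreeMonoid.casesOn with
      | one =>
        have := congrArg len (hmk hwx)
        rw [hlen, map_one, len_one] at this
        omega
      | of_mul v e' =>
        rw [mul_assoc] at h1 h2
        obtain ⟨rfl, rfl⟩ := inj h1
        obtain ⟨rfl, rfl⟩ := inj h2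
        rw [map_mul, len_mul] at hl
        rw [map_mul, map_mul, ← hmk hyz]
        exact (ih1 (by omega) rfl rfl).mul_right _

theorem localLcm (M : CoxeterMatrix S) [Finite M.Group] (n : ℕ) : LocalLcm M n := by
  induction n with
  | zero =>
    intro s t a b _ hl
    simp at hl
  | succ n ih =>
    intro s t a b h hl
    obtain ⟨a, rfl⟩ := PresentedMonoid.surjective_mk a
    obtain ⟨b, rfl⟩ := PresentedMonoid.surjective_mk b
    have h' : PresentedMonoid.mk (monoidRels M) (FreeMonoid.of s * a) =
        PresentedMonoid.mk (monoidRels M) (FreeMonoid.of t * b) := by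
      rw [map_mul, map_mul]; exact h
    refine completes_of_rel ih (PresentedMonoid.mk_eq_mk_iff.1 h') ?_ rfl rfl
    rw [map_mul]; exact hl

end ArtinTits

/-! ### Cancellation and reversal -/

namespace ArtinTits

open CoxeterSystem

variable {S : Type*} {M : CoxeterMatrix S}

local notation "cs" => CoxeterMatrix.toCoxeterSystem

/-- The image of a word is the product of its letters. -/
theorem mk_ofList (l : List S) :
    PresentedMonoid.mk (monoidRels M) (FreeMonoid.ofList l) = (l.map (atom M)).prod := by
  induction l with
  | nil => rfl
  | cons s l ih => rw [FreeMonoid.ofList_cons, map_mul, ih, List.map_cons, List.prod_cons]; rfl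

/-- The reversal anti-automorphism, as a homomorphism to the opposite monoid. -/
def revHom (M : CoxeterMatrix S) : ArtinMonoid M →* (ArtinMonoid M)ᵐᵒᵖ :=
  PresentedMonoid.lift (fun s => MulOpposite.op (atom M s)) (by
    have key : ∀ l : List S, (l.map fun s => MulOpposite.op (atom M s)).prod =
        MulOpposite.op (PresentedMonoid.mk (monoidRels M) (FreeMonoid.ofList l.reverse)) := by
      intro l
      rw [mk_ofList]
      induction l with
      | nil => simp
      | cons s l ih => simp [ih]
    rintro a b ⟨s, t, hst, h0, rfl, rfl⟩
    rw [lift_ofList, lift_ofList, key, key, reverse_altList, reverse_altList]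
    have h := alt_comm M hst h0
    unfold alt at h
    split_ifs
    · rw [h]
    · rw [h])

/-- The reversal of an element of the Artin–Tits monoid. -/
def rev (x : ArtinMonoid M) : ArtinMonoid M := (revHom M x).unop

@[simp] theorem rev_one : rev (1 : ArtinMonoid M) = 1 := by simp [rev]

@[simp] theorem rev_mul (x y : ArtinMonoid M) : rev (x * y) = rev y * rev x := by simp [rev]

@[simp] theorem rev_atom (s : S) : rev (atom M s) = atom M s := rfl

@[simp] theorem rev_rev (x : ArtinMonoid M) : rev (rev x) = x := by
  induction x using atom_induction with
  | one => simp
  | atom_mul s y ih => simp [ih]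

@[simp] theorem len_rev (x : ArtinMonoid M) : len (rev x) = len x := by
  induction x using atom_induction with
  | one => simp
  | atom_mul s y ih => simp [ih, add_comm]

theorem proj_rev (x : ArtinMonoid M) : proj M (rev x) = (proj M x)⁻¹ := by
  induction x using atom_induction with
  | one => simp
  | atom_mul s y ih => rw [rev_mul, map_mul, map_mul, ih, rev_atom, mul_inv_rev, proj_atom,
      inv_simple]

theorem IsSimple.rev {x : ArtinMonoid M} (h : IsSimple x) : IsSimple (rev x) := by
  rw [IsSimple, proj_rev, length_inv, len_rev, h]

theorem isSimple_atom (s : S) : IsSimple (atom M s) := by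
  rw [IsSimple, proj_atom, length_simple, len_atom]

instance [Finite M.Group] : IsCancelMul (ArtinMonoid M) where
  mul_left_cancel _ _ _ h := (localLcm M _).cancel h le_rfl
  mul_right_cancel x a b h := by
    have h' : rev x * rev a = rev x * rev b := by
      rw [← rev_mul, ← rev_mul]; exact congrArg rev h
    rw [← rev_rev a, ← rev_rev b, (localLcm M _).cancel h' le_rfl]

/-- A set `D` closed under left divisors and local lcms contains a greatest left divisor of
each `e`. -/
theorem exists_greatest_divisor [Finite M.Group] (e : ArtinMonoid M) {D : Set (ArtinMonoid M)}
    (h1 : 1 ∈ D) (hD : ∀ x y, x * y ∈ D → x ∈ D)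
    (hD' : ∀ a s t, s ≠ t → a * atom M s ∈ D → a * atom M t ∈ D → a * alt M s t (M s t) ∈ D) :
    ∃ z ∈ D, z ∣ e ∧ ∀ x ∈ D, x ∣ e → x ∣ z := by
  classical
  have hle : ∀ x : ArtinMonoid M, x ∣ e → len x ≤ len e := by
    rintro x ⟨c, rfl⟩; simp
  have hP : ∃ n, ∃ z ∈ D, z ∣ e ∧ len z = n := ⟨0, 1, h1, one_dvd _, len_one⟩
  have hb : ∀ n, (∃ z ∈ D, z ∣ e ∧ len z = n) → n ≤ len e := by
    rintro n ⟨z, -, hz, rfl⟩; exact hle z hz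
  obtain ⟨z, hz, hze, hl⟩ := Nat.findGreatest_spec
    (P := fun n => ∃ z ∈ D, z ∣ e ∧ len z = n) (hb _ hP.choose_spec) hP.choose_spec
  refine ⟨z, hz, hze, fun x hx hxe => ?_⟩
  obtain ⟨y, hy, hxy, ⟨c, rfl⟩, hye⟩ := (localLcm M _).directed le_rfl hD hD' hx hz hxe hze
  have hm : len (z * c) ≤ len z := by
    rw [hl]
    exact Nat.le_findGreatest (hle _ hye) ⟨_, hy, hye, rfl⟩
  have hc : c = 1 := len_eq_zero.1 (by rw [len_mul] at hm; omega)
  rwa [hc, mul_one] at hxy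

/-! ### Standard parabolic submonoids -/

/-- The submonoid of the Artin–Tits monoid generated by `T`. -/
def standardMonoid (M : CoxeterMatrix S) (T : Set S) : Submonoid (ArtinMonoid M) :=
  Submonoid.closure (atom M '' T)

open Classical in
/-- The multiplicative indicator of `standardMonoid M T`: the homomorphism to `ℕ` sending the
generators in `T` to `1` and the others to `0`. -/
noncomputable def supportHom (M : CoxeterMatrix S) (T : Set S) : ArtinMonoid M →* ℕ :=
  PresentedMonoid.lift (fun s => if s ∈ T then 1 else 0) (by
    have key : ∀ (k : ℕ) (s t : S),
        ((altList s t (k + 2)).map fun s => if s ∈ T then 1 else 0).prod =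
          (if s ∈ T then 1 else 0) * (if t ∈ T then 1 else 0) := by
      intro k
      induction k with
      | zero => intro s t; simp [altList]
      | succ k ih =>
        intro s t
        rw [altList, List.map_cons, List.prod_cons, ih t s]
        split_ifs <;> simp
    rintro a b ⟨s, t, hst, h0, rfl, rfl⟩
    have h1 : M s t ≠ 1 := M.off_diagonal s t hst
    obtain ⟨k, hk⟩ : ∃ k, M s t = k + 2 := ⟨M s t - 2, by omega⟩
    rw [lift_ofList, lift_ofList, hk, key, key, mul_comm])

open Classical in
theorem supportHom_atom (T : Set S) (s : S) :
    supportHom M T (atom M s) = if s ∈ T then 1 else 0 := rfl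

theorem mem_standardMonoid_iff {T : Set S} {x : ArtinMonoid M} :
    x ∈ standardMonoid M T ↔ supportHom M T x = 1 := by
  constructor
  · intro h
    induction h using Submonoid.closure_induction with
    | mem x hx => obtain ⟨s, hs, rfl⟩ := hx; rw [supportHom_atom, if_pos hs]
    | one => simp
    | mul x y _ _ h1 h2 => rw [map_mul, h1, h2]
  · intro h
    induction x using atom_induction with
    | one => exact Submonoid.one_mem _
    | atom_mul s y ih =>
      rw [map_mul, supportHom_atom, mul_eq_one] at h
      refine Submonoid.mul_mem _ (Submonoid.subset_closure ⟨s, ?_, rfl⟩) (ih h.2)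
      by_contra hs
      simp [hs] at h

theorem mul_mem_standardMonoid_iff {T : Set S} {x y : ArtinMonoid M} :
    x * y ∈ standardMonoid M T ↔ x ∈ standardMonoid M T ∧ y ∈ standardMonoid M T := by
  simp only [mem_standardMonoid_iff, map_mul, mul_eq_one]

theorem atom_mem_standardMonoid_iff {T : Set S} {s : S} :
    atom M s ∈ standardMonoid M T ↔ s ∈ T := by
  rw [mem_standardMonoid_iff, supportHom_atom]
  simp

theorem atom_injective (M : CoxeterMatrix S) : Function.Injective (atom M) := by
  intro s t h
  have : atom M s ∈ standardMonoid M {t} := by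
    rw [h, atom_mem_standardMonoid_iff]; rfl
  simpa using atom_mem_standardMonoid_iff.1 this

theorem standardMonoid_mono {X T : Set S} (h : X ⊆ T) :
    standardMonoid M X ≤ standardMonoid M T :=
  Submonoid.closure_mono (Set.image_mono h)

theorem mem_standardMonoid_univ (x : ArtinMonoid M) : x ∈ standardMonoid M Set.univ := by
  induction x using atom_induction with
  | one => exact Submonoid.one_mem _
  | atom_mul s y ih =>
    exact mul_mem_standardMonoid_iff.2 ⟨atom_mem_standardMonoid_iff.2 (Set.mem_univ s), ih⟩

theorem rev_mem_standardMonoid {T : Set S} {x : ArtinMonoid M} (hx : x ∈ standardMonoid M T) :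
    rev x ∈ standardMonoid M T := by
  induction x using atom_induction with
  | one => simp
  | atom_mul s y ih =>
    rw [mul_mem_standardMonoid_iff] at hx
    rw [rev_mul, mul_mem_standardMonoid_iff]
    exact ⟨ih hx.2, hx.1⟩

theorem alt_mem_standardMonoid {T : Set S} {s t : S} (hs : s ∈ T) (ht : t ∈ T) (k : ℕ) :
    alt M s t k ∈ standardMonoid M T := by
  induction k generalizing s t with
  | zero => exact Submonoid.one_mem _
  | succ k ih =>
    rw [alt_succ]
    exact mul_mem_standardMonoid_iff.2 ⟨atom_mem_standardMonoid_iff.2 hs, ih ht hs⟩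

theorem mul_alt_mem_standardMonoid {T : Set S} {a : ArtinMonoid M} {s t : S}
    (hs : a * atom M s ∈ standardMonoid M T) (ht : a * atom M t ∈ standardMonoid M T) :
    a * alt M s t (M s t) ∈ standardMonoid M T := by
  rw [mul_mem_standardMonoid_iff, atom_mem_standardMonoid_iff] at hs ht
  exact mul_mem_standardMonoid_iff.2 ⟨hs.1, alt_mem_standardMonoid hs.2 ht.2 _⟩

/-! ### The Garside elements -/

variable [Finite M.Group]

/-- The lift of the longest element of the Coxeter group is a multiple of all simple elements. -/
theorem exists_isSimple_forall_dvd (M : CoxeterMatrix S) [Finite M.Group] :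
    ∃ Δ : ArtinMonoid M, IsSimple Δ ∧ ∀ x, IsSimple x → x ∣ Δ := by
  obtain ⟨w₀, hw₀⟩ := exists_maximal_length M
  obtain ⟨Δ, hΔ, rfl⟩ := exists_isSimple_proj_eq w₀
  refine ⟨Δ, hΔ, fun x hx => ?_⟩
  obtain ⟨y, hy, hyp⟩ := exists_isSimple_proj_eq ((proj M x)⁻¹ * proj M Δ)
  have hp : proj M (x * y) = proj M Δ := by rw [map_mul, hyp, mul_inv_cancel_left]
  refine ⟨y, hΔ.eq_of_proj_eq ?_ hp.symm⟩
  rw [IsSimple, hp, len_mul, ← hx, ← hy, hyp, (cs M).length_add_of_maximal hw₀]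

/-- For each `T` there is a greatest simple element of the submonoid generated by `T`. -/
theorem exists_delta (M : CoxeterMatrix S) [Finite M.Group] (T : Set S) :
    ∃ D : ArtinMonoid M, D ∈ standardMonoid M T ∧ IsSimple D ∧
      ∀ x ∈ standardMonoid M T, IsSimple x → x ∣ D := by
  obtain ⟨Δ, hΔ, hdvd⟩ := exists_isSimple_forall_dvd M
  obtain ⟨z, hz, ⟨c, hc⟩, hmax⟩ := exists_greatest_divisor Δ (D := standardMonoid M T)
    (Submonoid.one_mem _) (fun x y h => (mul_mem_standardMonoid_iff.1 h).1)
    (fun a s t _ hs ht => mul_alt_mem_standardMonoid hs ht)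
  exact ⟨z, hz, (hc ▸ hΔ : IsSimple (z * c)).left, fun x hx hs => hmax x hx (hdvd x hs)⟩

/-- The Garside element `Δ_T` of the submonoid generated by `T`, defined as its greatest simple
element. -/
noncomputable def delta (M : CoxeterMatrix S) [Finite M.Group] (T : Set S) : ArtinMonoid M :=
  (exists_delta M T).choose

theorem delta_mem (T : Set S) : delta M T ∈ standardMonoid M T := (exists_delta M T).choose_spec.1

theorem isSimple_delta (T : Set S) : IsSimple (delta M T) := (exists_delta M T).choose_spec.2.1

theorem dvd_delta {T : Set S} {x : ArtinMonoid M} (hx : x ∈ standardMonoid M T)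
    (hs : IsSimple x) : x ∣ delta M T :=
  (exists_delta M T).choose_spec.2.2 x hx hs

theorem atom_dvd_delta {T : Set S} {s : S} (hs : s ∈ T) : atom M s ∣ delta M T :=
  dvd_delta (atom_mem_standardMonoid_iff.2 hs) (isSimple_atom s)

theorem rev_delta (T : Set S) : rev (delta M T) = delta M T := by
  obtain ⟨c, hc⟩ := dvd_delta (rev_mem_standardMonoid (delta_mem (M := M) T))
    (isSimple_delta T).rev
  have hl := congrArg len hc
  rw [len_mul, len_rev] at hl
  rw [len_eq_zero.1 (show len c = 0 by omega), mul_one] at hc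
  exact hc.symm

/-- `Δ_T` permutes the generators in `T` by an involution. -/
theorem exists_atom_mul_delta {T : Set S} {s : S} (hs : s ∈ T) :
    ∃ s' ∈ T, atom M s * delta M T = delta M T * atom M s' ∧
      atom M s' * delta M T = delta M T * atom M s := by
  obtain ⟨c, hc⟩ := atom_dvd_delta (M := M) hs
  have hsc : IsSimple (atom M s * c) := hc ▸ isSimple_delta T
  have hmc : atom M s * c ∈ standardMonoid M T := hc ▸ delta_mem T
  obtain ⟨x, hx⟩ := dvd_delta (mul_mem_standardMonoid_iff.1 hmc).2 hsc.right
  have hl := congrArg len (hc.symm.trans hx)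
  obtain ⟨s', rfl⟩ := exists_eq_atom (x := x) (by simp at hl; omega)
  have hs' : s' ∈ T := by
    have := delta_mem (M := M) T
    rw [hx, mul_mem_standardMonoid_iff, atom_mem_standardMonoid_iff] at this
    exact this.2
  have e : atom M s * delta M T = delta M T * atom M s' := by
    conv_lhs => rw [hx, ← mul_assoc, ← hc]
  refine ⟨s', hs', e, ?_⟩
  have := congrArg rev e
  rw [rev_mul, rev_mul, rev_delta, rev_atom, rev_atom] at this
  exact this.symm

/-- `Δ_T` is the least common right multiple of `T`. -/
theorem delta_dvd {T : Set S} {n : ArtinMonoid M} (h : ∀ t ∈ T, atom M t ∣ n) :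
    delta M T ∣ n := by
  obtain ⟨x, hxn, ⟨y, hy⟩, hmax⟩ := exists_greatest_divisor (delta M T)
    (D := {x | x ∣ n}) (one_dvd n) (fun x y hxy => (Dvd.intro y rfl).trans hxy) (by
      rintro a s t hst ⟨b, hb⟩ ⟨c, hc⟩
      rw [mul_assoc] at hb hc
      obtain ⟨d, hd, -⟩ := ((localLcm M _) s t b c
        (mul_left_cancel (hb.symm.trans hc)) le_rfl).2 hst
      have h0 := ne_zero_of_finite (cs M) s t
      exact ⟨d, by rw [hb, hd, ← mul_assoc (atom M s), ← alt_eq M s t h0, mul_assoc]⟩)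
  rcases eq_or_ne y 1 with rfl | hy1
  · rw [hy, mul_one]; exact hxn
  -- otherwise a proper left divisor `z` of `Δ_T` is a multiple of all letters of `T`
  exfalso
  obtain ⟨s, y', rfl⟩ := exists_mul_atom hy1
  have hz : ∀ t ∈ T, atom M t ∣ x * y' := fun t ht =>
    (hmax _ (h t ht) (atom_dvd_delta ht)).trans (Dvd.intro _ rfl)
  rw [← mul_assoc] at hy
  have hs : s ∈ T := by
    have := delta_mem (M := M) T
    rw [hy, mul_mem_standardMonoid_iff, atom_mem_standardMonoid_iff] at this
    exact this.2
  obtain ⟨s', hs', -, e⟩ := exists_atom_mul_delta (M := M) hs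
  obtain ⟨z', hz'⟩ := hz s' hs'
  have e2 : atom M s' * (x * y') = delta M T := by
    rw [hy, ← mul_assoc] at e
    rw [mul_right_cancel e, ← hy]
  rw [hz', ← mul_assoc] at e2
  exact not_isSimple_atom_mul_self s'
    (show IsSimple (atom M s' * atom M s' * z') from e2 ▸ isSimple_delta T).left

/-- `Δ_T` is the least common left multiple of `T`. -/
theorem exists_eq_mul_delta {T : Set S} {n : ArtinMonoid M}
    (h : ∀ t ∈ T, ∃ y, n = y * atom M t) : ∃ y, n = y * delta M T := by
  have : delta M T ∣ rev n := delta_dvd fun t ht => by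
    obtain ⟨y, rfl⟩ := h t ht
    exact ⟨rev y, by simp⟩
  obtain ⟨c, hc⟩ := this
  refine ⟨rev c, ?_⟩
  rw [← rev_rev n, hc, rev_mul, rev_delta]

theorem delta_eq_mul_atom {T : Set S} {t : S} (ht : t ∈ T) : ∃ y, delta M T = y * atom M t := by
  obtain ⟨c, hc⟩ := atom_dvd_delta (M := M) ht
  refine ⟨rev c, ?_⟩
  rw [← rev_delta, hc, rev_mul, rev_atom]

theorem commute_delta_sq {T : Set S} {x : ArtinMonoid M} (hx : x ∈ standardMonoid M T) :
    Commute x (delta M T ^ 2) := by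
  induction hx using Submonoid.closure_induction with
  | mem x hx =>
    obtain ⟨s, hs, rfl⟩ := hx
    obtain ⟨s', hs', e1, e2⟩ := exists_atom_mul_delta (M := M) hs
    rw [Commute, SemiconjBy, pow_two, ← mul_assoc, e1, mul_assoc, e2, mul_assoc]
  | one => exact Commute.one_left _
  | mul x y _ _ h1 h2 => exact h1.mul_left h2

/-- Every element of the submonoid generated by `T` divides a power of `Δ_T ^ 2`. -/
theorem exists_dvd_delta_sq_pow {T : Set S} {x : ArtinMonoid M} (hx : x ∈ standardMonoid M T) :
    ∃ n : ℕ, ∃ y ∈ standardMonoid M T, (delta M T ^ 2) ^ n = x * y := by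
  induction x using atom_induction with
  | one => exact ⟨0, 1, Submonoid.one_mem _, by simp⟩
  | atom_mul s x ih =>
    rw [mul_mem_standardMonoid_iff] at hx
    obtain ⟨n, y, hy, e⟩ := ih hx.2
    obtain ⟨c, hc⟩ := dvd_delta hx.1 (isSimple_atom s)
    refine ⟨n + 1, y * (c * delta M T), ?_, ?_⟩
    · refine Submonoid.mul_mem _ hy (Submonoid.mul_mem _ ?_ (delta_mem T))
      have := delta_mem (M := M) T
      rw [hc, mul_mem_standardMonoid_iff] at this
      exact this.2
    · have hs := (commute_delta_sq hx.1).pow_right n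
      calc (delta M T ^ 2) ^ (n + 1) = (delta M T ^ 2) ^ n * (delta M T * delta M T) := by
            rw [pow_succ, pow_two (delta M T)]
        _ = (delta M T ^ 2) ^ n * (atom M s * (c * delta M T)) := by
            conv_lhs => enter [2, 1]; rw [hc]
            rw [mul_assoc]
        _ = atom M s * (delta M T ^ 2) ^ n * (c * delta M T) := by
            rw [← mul_assoc, ← hs.eq]
        _ = _ := by rw [e]; simp only [mul_assoc]

end ArtinTits

/-! ### Ribbons -/

namespace ArtinTits

open CoxeterSystem

variable {S : Type*} {M : CoxeterMatrix S}

/-- `d` conjugates the set of generators `X` onto the set of generators `Y`, i.e. `d X = Y d`. -/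
def Conjugates (d : ArtinMonoid M) (X Y : Set S) : Prop :=
  (∀ x ∈ X, ∃ y ∈ Y, d * atom M x = atom M y * d) ∧
    ∀ y ∈ Y, ∃ x ∈ X, d * atom M x = atom M y * d

theorem Conjugates.exists_mul_eq {d : ArtinMonoid M} {X Y : Set S} (h : Conjugates d X Y)
    {w : ArtinMonoid M} (hw : w ∈ standardMonoid M X) :
    ∃ w' ∈ standardMonoid M Y, d * w = w' * d := by
  induction hw using Submonoid.closure_induction with
  | mem w hw =>
    obtain ⟨x, hx, rfl⟩ := hw
    obtain ⟨y, hy, e⟩ := h.1 x hx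
    exact ⟨_, atom_mem_standardMonoid_iff.2 hy, e⟩
  | one => exact ⟨1, Submonoid.one_mem _, by simp⟩
  | mul a b _ _ ha hb =>
    obtain ⟨a', ha', ea⟩ := ha
    obtain ⟨b', hb', eb⟩ := hb
    exact ⟨a' * b', Submonoid.mul_mem _ ha' hb', by rw [← mul_assoc, ea, mul_assoc, eb, mul_assoc]⟩

theorem Conjugates.exists_mul_eq' {d : ArtinMonoid M} {X Y : Set S} (h : Conjugates d X Y)
    {w : ArtinMonoid M} (hw : w ∈ standardMonoid M Y) :
    ∃ w' ∈ standardMonoid M X, d * w' = w * d := by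
  induction hw using Submonoid.closure_induction with
  | mem w hw =>
    obtain ⟨y, hy, rfl⟩ := hw
    obtain ⟨x, hx, e⟩ := h.2 y hy
    exact ⟨_, atom_mem_standardMonoid_iff.2 hx, e⟩
  | one => exact ⟨1, Submonoid.one_mem _, by simp⟩
  | mul a b _ _ ha hb =>
    obtain ⟨a', ha', ea⟩ := ha
    obtain ⟨b', hb', eb⟩ := hb
    exact ⟨a' * b', Submonoid.mul_mem _ ha' hb', by rw [← mul_assoc, ea, mul_assoc, eb, mul_assoc]⟩

theorem exists_left_factor (X : Set S) (g : ArtinMonoid M) :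
    ∃ a ∈ standardMonoid M X, ∃ g', g = a * g' ∧ ∀ x ∈ X, ¬ atom M x ∣ g' := by
  obtain ⟨n, hn⟩ : ∃ n, len g = n := ⟨_, rfl⟩
  induction n using Nat.strong_induction_on generalizing g with
  | _ n ih =>
  by_cases h : ∃ x ∈ X, atom M x ∣ g
  · obtain ⟨x, hx, g₁, rfl⟩ := h
    obtain ⟨a, ha, g', rfl, hg'⟩ := ih (len g₁) (by rw [← hn, len_mul, len_atom]; omega) g₁ rfl
    exact ⟨atom M x * a, Submonoid.mul_mem _ (atom_mem_standardMonoid_iff.2 hx) ha, g',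
      by rw [mul_assoc], hg'⟩
  · exact ⟨1, Submonoid.one_mem _, g, by simp, fun x hx hd => h ⟨x, hx, hd⟩⟩

theorem exists_right_factor (X : Set S) (g : ArtinMonoid M) :
    ∃ c ∈ standardMonoid M X, ∃ r, g = r * c ∧ ∀ x ∈ X, ∀ y, r ≠ y * atom M x := by
  obtain ⟨a, ha, g', e, hg'⟩ := exists_left_factor X (rev g)
  refine ⟨rev a, rev_mem_standardMonoid ha, rev g', by rw [← rev_mul, ← e, rev_rev], ?_⟩
  intro x hx y hy
  refine hg' x hx ⟨rev y, ?_⟩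
  rw [← rev_rev g', hy, rev_mul, rev_atom]

variable [Finite M.Group]

theorem Conjugates.mul_delta {d : ArtinMonoid M} {X Y : Set S} (h : Conjugates d X Y) :
    d * delta M X = delta M Y * d := by
  obtain ⟨w, hw, e⟩ := h.exists_mul_eq (delta_mem X)
  obtain ⟨w', hw', e'⟩ := h.exists_mul_eq' (delta_mem Y)
  -- `w` is a common multiple of `Y`, and `w'` is a common multiple of `X`
  obtain ⟨c, rfl⟩ : delta M Y ∣ w := delta_dvd fun y hy => by
    obtain ⟨x, hx, exy⟩ := h.2 y hy
    obtain ⟨c, hc⟩ := atom_dvd_delta (M := M) hx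
    have hcX : c ∈ standardMonoid M X := by
      have := delta_mem (M := M) X
      rw [hc, mul_mem_standardMonoid_iff] at this
      exact this.2
    obtain ⟨c', -, ec⟩ := h.exists_mul_eq hcX
    refine ⟨c', mul_right_cancel (b := d) ?_⟩
    rw [← e, hc, ← mul_assoc, exy, mul_assoc, ec, mul_assoc]
  obtain ⟨c', rfl⟩ : ∃ c', w' = c' * delta M X := exists_eq_mul_delta fun x hx => by
    obtain ⟨y, hy, exy⟩ := h.1 x hx
    obtain ⟨c, hc⟩ := delta_eq_mul_atom (M := M) hy
    have hcY : c ∈ standardMonoid M Y := by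
      have := delta_mem (M := M) Y
      rw [hc, mul_mem_standardMonoid_iff] at this
      exact this.1
    obtain ⟨c', -, ec⟩ := h.exists_mul_eq' hcY
    refine ⟨c', mul_left_cancel (a := d) ?_⟩
    rw [e', hc, mul_assoc, ← exy, ← mul_assoc, ← ec, mul_assoc]
  have h1 := congrArg len e
  have h2 := congrArg len e'
  simp only [len_mul] at h1 h2
  rw [e, len_eq_zero.1 (show len c = 0 by omega), mul_one]

theorem Conjugates.mul_delta_pow {d : ArtinMonoid M} {X Y : Set S} (h : Conjugates d X Y)
    (k : ℕ) : d * delta M X ^ k = delta M Y ^ k * d :=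
  (SemiconjBy.pow_right (show SemiconjBy d (delta M X) (delta M Y) from h.mul_delta) k).eq

/-- The elementary ribbon `d` with `Δ_{X ∪ {s}} = d Δ_X`, for `s ∉ X`. -/
theorem exists_elementary_ribbon {X : Set S} {s : S} (hs : s ∉ X) :
    ∃ d : ArtinMonoid M, delta M (insert s X) = d * delta M X ∧
      (∃ y, d = y * atom M s) ∧ ∃ Y, Conjugates d X Y := by
  have hXT : X ⊆ insert s X := Set.subset_insert s X
  obtain ⟨c, hc⟩ := dvd_delta (standardMonoid_mono hXT (delta_mem (M := M) X)) (isSimple_delta X)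
  have hd : delta M (insert s X) = rev c * delta M X := by
    rw [← rev_delta (insert s X), hc, rev_mul, rev_delta]
  refine ⟨rev c, hd, ?_, {y | ∃ x ∈ X, rev c * atom M x = atom M y * rev c}, ?_, ?_⟩
  · have hdT := delta_mem (M := M) (insert s X)
    rw [hd, mul_mem_standardMonoid_iff] at hdT
    have hd1 : rev c ≠ 1 := by
      intro h1
      rw [h1, one_mul] at hd
      obtain ⟨y, hy⟩ := atom_dvd_delta (M := M) (Set.mem_insert s X)
      have := delta_mem (M := M) X
      rw [← hd, hy, mul_mem_standardMonoid_iff, atom_mem_standardMonoid_iff] at this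
      exact hs this.1
    obtain ⟨t, y, hy⟩ := exists_mul_atom hd1
    have ht := hdT.1
    rw [hy, mul_mem_standardMonoid_iff, atom_mem_standardMonoid_iff] at ht
    rcases ht.2 with rfl | htX
    · exact ⟨y, hy⟩
    · -- a last letter in `X` would produce a square inside the simple element
      exfalso
      obtain ⟨b, hb⟩ := atom_dvd_delta (M := M) htX
      have h2 : IsSimple (y * ((atom M t * atom M t) * b)) := by
        have : y * ((atom M t * atom M t) * b) = delta M (insert s X) := by
          rw [hd, hy, hb]; simp only [mul_assoc]
        rw [this]; exact isSimple_delta _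
      exact not_isSimple_atom_mul_self t (IsSimple.left (IsSimple.right h2))
  · intro x hx
    obtain ⟨x', hx', e1, e2⟩ := exists_atom_mul_delta (M := M) hx
    obtain ⟨y, hy, e3, e4⟩ := exists_atom_mul_delta (M := M) (hXT hx')
    have e : rev c * atom M x = atom M y * rev c := by
      refine mul_right_cancel (b := delta M X) ?_
      rw [mul_assoc, e1, ← mul_assoc, ← hd, ← e4, hd, mul_assoc]
    exact ⟨y, ⟨x, hx, e⟩, e⟩
  · rintro y ⟨x, hx, e⟩
    exact ⟨x, hx, e⟩

/-- If `r` conjugates a positive power of `Δ_X` to a positive element, and no letter of `X`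
divides `r` on the right, then `r` conjugates `X` to a set of generators: `r` is a product of
elementary ribbons. -/
theorem exists_conjugates_of_mul_delta_pow {X : Set S} {r q : ArtinMonoid M} {k : ℕ}
    (h : r * delta M X ^ (k + 1) = q * r) (hr : ∀ x ∈ X, ∀ y, r ≠ y * atom M x) :
    ∃ Y, Conjugates r X Y := by
  obtain ⟨n, hn⟩ : ∃ n, len r = n := ⟨_, rfl⟩
  induction n using Nat.strong_induction_on generalizing X r with
  | _ n ih =>
  by_cases hr1 : r = 1
  · subst hr1
    exact ⟨X, fun x hx => ⟨x, hx, by simp⟩, fun x hx => ⟨x, hx, by simp⟩⟩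
  obtain ⟨s, r₁, hr₁⟩ := exists_mul_atom hr1
  have hs : s ∉ X := fun hs => hr s hs _ hr₁
  obtain ⟨d, hd, ⟨d', hd'⟩, Y, hY⟩ := exists_elementary_ribbon (M := M) hs
  -- peel the factors `Δ_X` off `r Δ_X ^ (k + 1)`, which is a left multiple of `s` and of `X`
  have key : ∀ j, (∃ y, r * delta M X ^ (j + 1) = y * atom M s) → ∃ y, r = y * d := by
    intro j
    induction j with
    | zero =>
      intro h1
      obtain ⟨y, hy⟩ : ∃ y, r * delta M X ^ (0 + 1) = y * delta M (insert s X) := by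
        refine exists_eq_mul_delta ?_
        rintro t (rfl | ht)
        · exact h1
        · obtain ⟨y, hy⟩ := delta_eq_mul_atom (M := M) ht
          exact ⟨r * y, by rw [zero_add, pow_one, hy, mul_assoc]⟩
      rw [zero_add, pow_one, hd, ← mul_assoc] at hy
      exact ⟨y, mul_right_cancel hy⟩
    | succ j ihj =>
      intro h1
      obtain ⟨y, hy⟩ : ∃ y, r * delta M X ^ (j + 1 + 1) = y * delta M (insert s X) := by
        refine exists_eq_mul_delta ?_
        rintro t (rfl | ht)
        · exact h1
        · obtain ⟨y, hy⟩ := delta_eq_mul_atom (M := M) ht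
          exact ⟨r * delta M X ^ (j + 1) * y, by rw [pow_succ _ (j + 1), hy]; simp only [mul_assoc]⟩
      rw [pow_succ _ (j + 1), hd, ← mul_assoc, ← mul_assoc] at hy
      exact ihj ⟨y * d', by rw [mul_right_cancel hy, mul_assoc, ← hd']⟩
  obtain ⟨r', rfl⟩ := key k ⟨q * r₁, by rw [h, mul_assoc, ← hr₁]⟩
  have hlen : len r' < n := by
    rw [← hn, len_mul, hd', len_mul, len_atom]; omega
  obtain ⟨Z, hZ⟩ := ih (len r') hlen (X := Y) (r := r')
    (by
      refine mul_right_cancel (b := d) ?_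
      rw [mul_assoc, ← hY.mul_delta_pow, ← mul_assoc, h, mul_assoc])
    (by
      intro y hy z hz
      obtain ⟨x, hx, e⟩ := hY.2 y hy
      exact hr x hx (z * d) (by rw [hz, mul_assoc, ← e, mul_assoc]))
    rfl
  refine ⟨Z, fun x hx => ?_, fun z hz => ?_⟩
  · obtain ⟨y, hy, e⟩ := hY.1 x hx
    obtain ⟨z, hz, e'⟩ := hZ.1 y hy
    exact ⟨z, hz, by rw [mul_assoc, e, ← mul_assoc, e', mul_assoc]⟩
  · obtain ⟨y, hy, e'⟩ := hZ.2 z hz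
    obtain ⟨x, hx, e⟩ := hY.2 y hy
    exact ⟨x, hx, by rw [mul_assoc, e, ← mul_assoc, e', mul_assoc]⟩

/-- If no letter of `X` divides `g` on the left, then `p` is the greatest left divisor of `p g`
in the submonoid generated by `X`. -/
theorem dvd_of_dvd_mul {X : Set S} {p u g : ArtinMonoid M} (hp : p ∈ standardMonoid M X)
    (hu : u ∈ standardMonoid M X) (hg : ∀ x ∈ X, ¬ atom M x ∣ g) (h : u ∣ p * g) : u ∣ p := by
  obtain ⟨z, hz, huz, ⟨z', rfl⟩, y, hy⟩ := (localLcm M _).directed (le_refl (len (p * g)))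
    (D := standardMonoid M X) (fun x y h => (mul_mem_standardMonoid_iff.1 h).1)
    (fun a s t _ hs ht => mul_alt_mem_standardMonoid hs ht) hu hp h ⟨g, rfl⟩
  rw [mul_assoc] at hy
  have hg' : g = z' * y := mul_left_cancel hy
  by_cases h1 : z' = 1
  · rwa [h1, mul_one] at huz
  · exfalso
    obtain ⟨s, z'', rfl⟩ := exists_atom_mul h1
    have hs : s ∈ X := by
      have := (mul_mem_standardMonoid_iff.1 hz).2
      rw [mul_mem_standardMonoid_iff, atom_mem_standardMonoid_iff] at this
      exact this.1
    exact hg s hs ⟨z'' * y, by rw [hg', mul_assoc]⟩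

/-- The positive form of the main theorem: a positive element `g` conjugating a power of `Δ_X`
into the parabolic subgroup factors as an element of the parabolic submonoid times an element
permuting `X` by conjugation. -/
theorem exists_eq_mul_conjugates [Finite S] {X : Set S} {g p : ArtinMonoid M} {m k : ℕ}
    (hp : p ∈ standardMonoid M X)
    (h : (delta M X ^ 2) ^ m * g * (delta M X ^ 2) ^ (k + 1) = p * g) :
    ∃ b ∈ standardMonoid M X, ∃ r, g = b * r ∧ Conjugates r X X := by
  obtain ⟨a, ha, g', rfl, hg'⟩ := exists_left_factor X g
  have hδ : ∀ n, (delta M X ^ 2) ^ n ∈ standardMonoid M X := fun n =>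
    Submonoid.pow_mem _ (Submonoid.pow_mem _ (delta_mem X) _) _
  have hdvd : a * (delta M X ^ 2) ^ m ∣ p * a := by
    refine dvd_of_dvd_mul (Submonoid.mul_mem _ hp ha) (Submonoid.mul_mem _ ha (hδ m)) hg'
      ⟨g' * (delta M X ^ 2) ^ (k + 1), ?_⟩
    rw [mul_assoc p, ← h, ((commute_delta_sq ha).pow_right m).eq]
    simp only [mul_assoc]
  obtain ⟨q, hq⟩ := hdvd
  have hqX : q ∈ standardMonoid M X := by
    have := Submonoid.mul_mem _ hp ha
    rw [hq, mul_mem_standardMonoid_iff] at this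
    exact this.2
  have h1 : g' * (delta M X ^ 2) ^ (k + 1) = q * g' := by
    refine mul_left_cancel (a := a * (delta M X ^ 2) ^ m) ?_
    rw [← mul_assoc _ q, ← hq, mul_assoc p, ← h, ((commute_delta_sq ha).pow_right m).eq]
    simp only [mul_assoc]
  obtain ⟨c, hc, r, rfl, hr⟩ := exists_right_factor X g'
  have h2 : r * (delta M X ^ 2) ^ (k + 1) = q * r := by
    refine mul_right_cancel (b := c) ?_
    rw [mul_assoc, ← ((commute_delta_sq hc).pow_right (k + 1)).eq, ← mul_assoc, h1, mul_assoc]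
  rw [← pow_mul, show 2 * (k + 1) = (2 * k + 1) + 1 by ring] at h2
  obtain ⟨Y, hY⟩ := exists_conjugates_of_mul_delta_pow h2 hr
  have hqY : delta M Y ^ (2 * k + 1 + 1) = q := by
    refine mul_right_cancel (b := r) ?_
    rw [← h2, hY.mul_delta_pow]
  have hYX : Y ⊆ X := by
    intro y hy
    obtain ⟨b, hb⟩ := atom_dvd_delta (M := M) hy
    rw [← hqY, pow_succ', mul_mem_standardMonoid_iff, hb, mul_mem_standardMonoid_iff,
      atom_mem_standardMonoid_iff] at hqX
    exact hqX.1.1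
  -- conjugation by `r` is an injective self-map of the finite set `X`
  have hXX : Conjugates r X X := by
    choose f hf using hY.1
    refine ⟨fun x hx => ⟨f x hx, hYX (hf x hx).1, (hf x hx).2⟩, ?_⟩
    have hinj : Function.Injective (fun x : X => (⟨f x x.2, hYX (hf x x.2).1⟩ : X)) := by
      intro x x' hxx
      have e : f x x.2 = f x' x'.2 := congrArg Subtype.val hxx
      have h3 := (hf x x.2).2
      rw [e, ← (hf x' x'.2).2] at h3
      exact Subtype.ext (atom_injective M (mul_left_cancel h3))
    intro y hy
    obtain ⟨x, hx⟩ := Finite.surjective_of_injective hinj ⟨y, hy⟩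
    have e : f x x.2 = y := congrArg Subtype.val hx
    exact ⟨x, x.2, by rw [(hf x x.2).2, e]⟩
  obtain ⟨c', hc', e⟩ := hXX.exists_mul_eq hc
  exact ⟨a * c', Submonoid.mul_mem _ ha hc', r, by rw [e, mul_assoc], hXX⟩

end ArtinTits

/-! ### From the monoid to the group -/

namespace ArtinTits

open CoxeterSystem

variable {S : Type*} (M : CoxeterMatrix S)

theorem mk_braidProd (s t : S) :
    PresentedGroup.mk (braidRelators M) (braidProd M s t) =
      ((braidWord M s t).map (gen M)).prod := by
  rw [braidProd, map_list_prod, List.map_map]; rfl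

theorem prod_braidWord_gen {s t : S} (hst : s ≠ t) (h0 : M s t ≠ 0) :
    ((braidWord M s t).map (gen M)).prod = ((braidWord M t s).map (gen M)).prod := by
  rw [← mk_braidProd, ← mk_braidProd]
  exact PresentedGroup.mk_eq_mk_of_mul_inv_mem ⟨s, t, hst, h0, rfl⟩

/-- The canonical homomorphism from the Artin–Tits monoid to the Artin–Tits group. -/
def toGroup : ArtinMonoid M →* ArtinGroup M :=
  PresentedMonoid.lift (gen M) (by
    rintro a b ⟨s, t, hst, h0, rfl, rfl⟩
    have h := prod_braidWord_gen M hst h0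
    rw [braidWord, braidWord, M.symmetric t s, alternatingWord_eq_altList,
      alternatingWord_eq_altList] at h
    rw [lift_ofList, lift_ofList]
    split_ifs at h
    · exact h
    · exact h.symm)

@[simp] theorem toGroup_atom (s : S) : toGroup M (atom M s) = gen M s := rfl

variable {M}

/-! ### Parabolic subgroups and quasi-centralizers -/

theorem parabolicMonoid_eq_map (X : Set S) :
    parabolicMonoid M X = (standardMonoid M X).map (toGroup M) := by
  rw [standardMonoid, MonoidHom.map_mclosure, parabolicMonoid, gens, Set.image_image]
  rfl

theorem toGroup_mem_parabolic {X : Set S} {x : ArtinMonoid M} (hx : x ∈ standardMonoid M X) :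
    toGroup M x ∈ parabolic M X := by
  have h : parabolicMonoid M X ≤ (parabolic M X).toSubmonoid :=
    Submonoid.closure_le.2 Subgroup.subset_closure
  exact h (by rw [parabolicMonoid_eq_map]; exact ⟨x, hx, rfl⟩)

theorem mem_parabolic_univ (g : ArtinGroup M) : g ∈ parabolic M Set.univ := by
  rw [parabolic, gens, Set.image_univ]
  exact PresentedGroup.closure_range_of (braidRelators M) ▸ Subgroup.mem_top g

theorem mem_quasiCentralizer_iff {X : Set S} {g : ArtinGroup M} :
    g ∈ quasiCentralizer (gens M X) ↔
      (∀ x ∈ X, ∃ y ∈ X, g * gen M x = gen M y * g) ∧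
        ∀ y ∈ X, ∃ x ∈ X, g * gen M x = gen M y * g := by
  rw [quasiCentralizer, Set.mem_ofPred_eq, gens, Set.image_image, Set.image_image,
    Set.Subset.antisymm_iff]
  refine and_congr ⟨fun h x hx => ?_, ?_⟩ ⟨fun h y hy => ?_, ?_⟩
  · obtain ⟨y, hy, e⟩ := h ⟨x, hx, rfl⟩
    exact ⟨y, hy, e.symm⟩
  · rintro h _ ⟨x, hx, rfl⟩
    obtain ⟨y, hy, e⟩ := h x hx
    exact ⟨y, hy, e.symm⟩
  · exact h ⟨y, hy, rfl⟩
  · rintro h _ ⟨y, hy, rfl⟩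
    exact h y hy

theorem quasiCentralizer_subset_normalizer (X : Set S) :
    quasiCentralizer (gens M X) ⊆
      (Subgroup.normalizer (parabolic M X : Set (ArtinGroup M)) : Set (ArtinGroup M)) := by
  intro g hg
  have key : MulAut.conj g '' gens M X = gens M X := by
    rw [mem_quasiCentralizer_iff] at hg
    refine Set.Subset.antisymm ?_ ?_
    · rintro _ ⟨_, ⟨x, hx, rfl⟩, rfl⟩
      obtain ⟨y, hy, e⟩ := hg.1 x hx
      exact ⟨y, hy, by rw [MulAut.conj_apply, e, mul_inv_cancel_right]⟩
    · rintro _ ⟨y, hy, rfl⟩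
      obtain ⟨x, hx, e⟩ := hg.2 y hy
      exact ⟨gen M x, ⟨x, hx, rfl⟩, by rw [MulAut.conj_apply, e, mul_inv_cancel_right]⟩
  have h2 : (parabolic M X).map (MulAut.conj g).toMonoidHom = parabolic M X := by
    rw [parabolic, MonoidHom.map_closure]
    congr 1
  rw [SetLike.mem_coe, Subgroup.mem_normalizer_iff_conj_image_eq]
  exact congrArg (fun H : Subgroup (ArtinGroup M) => (H : Set (ArtinGroup M))) h2

theorem conj_mem_of_mem_normalizingSet {X : Set S} {g : ArtinGroup M}
    (hg : g ∈ normalizingSet (gens M X)) {a : ArtinGroup M} (ha : a ∈ parabolic M X) :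
    g * a * g⁻¹ ∈ parabolic M X := by
  have h : parabolic M X ≤ (parabolic M X).comap (MulAut.conj g).toMonoidHom := by
    refine (Subgroup.closure_le _).2 fun y hy => ?_
    obtain ⟨b, hb, e⟩ := hg ⟨y, hy, rfl⟩
    change g * y * g⁻¹ ∈ parabolic M X
    have e' : b * g = g * y := e
    rw [← e', mul_inv_cancel_right]
    exact hb
  exact h ha

/-! ### The monoid embeds in the group -/

variable [Finite M.Group]

theorem exists_mul_eq_delta_sq_pow (x : ArtinMonoid M) :
    ∃ (n : ℕ) (y : ArtinMonoid M), y * x = (delta M Set.univ ^ 2) ^ n := by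
  obtain ⟨n, y, -, e⟩ := exists_dvd_delta_sq_pow (mem_standardMonoid_univ x)
  refine ⟨n, y, mul_left_cancel (a := x) ?_⟩
  rw [← mul_assoc, ← e, ((commute_delta_sq (mem_standardMonoid_univ x)).pow_right n).eq]

theorem exists_common_left_multiple (r s : ArtinMonoid M) : ∃ u v, u * r = v * s := by
  obtain ⟨n, y, hy⟩ := exists_mul_eq_delta_sq_pow r
  obtain ⟨m, z, hz⟩ := exists_mul_eq_delta_sq_pow s
  refine ⟨(delta M Set.univ ^ 2) ^ m * y, (delta M Set.univ ^ 2) ^ n * z, ?_⟩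
  rw [mul_assoc, mul_assoc, hy, hz, ← pow_add, ← pow_add, add_comm]

/-- The Artin–Tits monoid of spherical type is an Ore monoid. -/
noncomputable instance : OreLocalization.OreSet (⊤ : Submonoid (ArtinMonoid M)) where
  ore_right_cancel r₁ r₂ s h := ⟨1, by rw [mul_right_cancel h]⟩
  oreNum r s := (exists_common_left_multiple r (s : ArtinMonoid M)).choose_spec.choose
  oreDenom r s := ⟨(exists_common_left_multiple r (s : ArtinMonoid M)).choose, Submonoid.mem_top _⟩
  ore_eq r s := (exists_common_left_multiple r (s : ArtinMonoid M)).choose_spec.choose_spec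

/-- The monoid of fractions of the Artin–Tits monoid. -/
local notation "Frac" => OreLocalization (⊤ : Submonoid (ArtinMonoid M)) (ArtinMonoid M)

variable (M) in
/-- The homomorphism from the Artin–Tits group to the units of the monoid of fractions. -/
noncomputable def toFractions : ArtinGroup M →* Fracˣ :=
  PresentedGroup.toGroup
    (f := fun s => OreLocalization.numeratorUnit ⟨atom M s, Submonoid.mem_top _⟩) (by
    rintro r ⟨s, t, hst, h0, rfl⟩
    rw [map_mul, map_inv, mul_inv_eq_one]
    have key : ∀ s t : S, ((FreeGroup.lift fun s =>
        (OreLocalization.numeratorUnit ⟨atom M s, Submonoid.mem_top _⟩ : Fracˣ))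
          (braidProd M s t) : Frac) =
        OreLocalization.numeratorHom ((braidWord M s t).map (atom M)).prod := by
      intro s t
      rw [braidProd, map_list_prod, map_list_prod, List.map_map, List.map_map,
        ← Units.coeHom_apply, map_list_prod, List.map_map]
      congr 1
      apply List.map_congr_left
      intro a _
      simp only [Function.comp_apply, FreeGroup.lift_apply_of]
      rfl
    apply Units.ext
    rw [key, key]
    congr 1
    rw [braidWord, braidWord, M.symmetric t s, alternatingWord_eq_altList,
      alternatingWord_eq_altList, ← mk_ofList, ← mk_ofList]
    have h := alt_comm M hst h0
    unfold alt at h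
    split_ifs
    · exact h
    · exact h.symm)

theorem toFractions_toGroup (x : ArtinMonoid M) :
    (toFractions M (toGroup M x) : Frac) = OreLocalization.numeratorHom x := by
  have h : ((Units.coeHom _).comp (toFractions M)).comp (toGroup M) =
      (OreLocalization.numeratorHom : ArtinMonoid M →* Frac) := by
    apply PresentedMonoid.ext
    intro s
    change ((toFractions M (PresentedGroup.of s) : Fracˣ) : Frac) = _
    rw [toFractions, PresentedGroup.toGroup.of]
    rfl
  exact DFunLike.congr_fun h x

/-- The Artin–Tits monoid of spherical type embeds in its group. -/
theorem toGroup_injective : Function.Injective (toGroup M) := by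
  intro x y h
  have h' : (OreLocalization.numeratorHom x : Frac) = OreLocalization.numeratorHom y := by
    rw [← toFractions_toGroup, ← toFractions_toGroup, h]
  rw [OreLocalization.numeratorHom_apply, OreLocalization.numeratorHom_apply,
    OreLocalization.oreDiv_eq_iff] at h'
  obtain ⟨u, v, h1, h2⟩ := h'
  have h3 : (u : ArtinMonoid M) = v := by simpa using h2
  have h4 : (u : ArtinMonoid M) * y = v * x := h1
  rw [h3] at h4
  exact (mul_left_cancel h4).symm

/-! ### Positive elements and Garside elements of parabolic subgroups -/

theorem toGroup_mem_parabolicMonoid_iff {X : Set S} {x : ArtinMonoid M} :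
    toGroup M x ∈ parabolicMonoid M X ↔ x ∈ standardMonoid M X := by
  rw [parabolicMonoid_eq_map]
  exact Submonoid.mem_map_iff_mem toGroup_injective

theorem commute_delta_sq_of_mem_parabolic {X : Set S} {g : ArtinGroup M}
    (hg : g ∈ parabolic M X) : Commute g (toGroup M (delta M X ^ 2)) := by
  have h : parabolic M X ≤ Subgroup.centralizer {toGroup M (delta M X ^ 2)} := by
    refine (Subgroup.closure_le _).2 ?_
    rintro _ ⟨s, hs, rfl⟩
    rw [SetLike.mem_coe, Subgroup.mem_centralizer_singleton_iff, ← toGroup_atom, ← map_mul,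
      ← map_mul, (commute_delta_sq (atom_mem_standardMonoid_iff.2 hs)).eq]
  exact Subgroup.mem_centralizer_singleton_iff.1 (h hg)

/-- Every element of a parabolic subgroup becomes positive after multiplication by a power of
the central element `Δ_X ^ 2`. -/
theorem exists_delta_sq_pow_mul_eq {X : Set S} {g : ArtinGroup M} (hg : g ∈ parabolic M X) :
    ∃ (n : ℕ), ∃ p ∈ standardMonoid M X, toGroup M (delta M X ^ 2) ^ n * g = toGroup M p := by
  have hδ : ∀ n : ℕ, (delta M X ^ 2) ^ n ∈ standardMonoid M X := fun n =>
    Submonoid.pow_mem _ (Submonoid.pow_mem _ (delta_mem X) _) _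
  unfold parabolic at hg
  induction hg using Subgroup.closure_induction with
  | mem g hg =>
    obtain ⟨s, hs, rfl⟩ := hg
    exact ⟨0, atom M s, atom_mem_standardMonoid_iff.2 hs, by simp⟩
  | one => exact ⟨0, 1, Submonoid.one_mem _, by simp⟩
  | mul g h hg hh ihg ihh =>
    obtain ⟨n, p, hp, e⟩ := ihg
    obtain ⟨m, q, hq, e'⟩ := ihh
    refine ⟨n + m, p * q, Submonoid.mul_mem _ hp hq, ?_⟩
    have hc := (commute_delta_sq_of_mem_parabolic hg).pow_right m
    rw [map_mul, ← e, ← e', pow_add, mul_assoc, ← mul_assoc _ g, ← hc.eq]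
    simp only [mul_assoc]
  | inv g hg ih =>
    obtain ⟨n, p, hp, e⟩ := ih
    obtain ⟨m, y, hy, e'⟩ := exists_dvd_delta_sq_pow hp
    refine ⟨m, y * (delta M X ^ 2) ^ n, Submonoid.mul_mem _ hy (hδ n), ?_⟩
    have hc := (commute_delta_sq_of_mem_parabolic hg).pow_right n
    have e2 : toGroup M (delta M X ^ 2) ^ m =
        g * (toGroup M y * toGroup M (delta M X ^ 2) ^ n) := by
      have hcy := (commute_delta_sq_of_mem_parabolic (toGroup_mem_parabolic hy)).pow_right n
      rw [← map_pow, e', map_mul, ← e, hcy.eq, ← mul_assoc, hc.eq]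
    have hcg := (commute_delta_sq_of_mem_parabolic (Subgroup.inv_mem _ hg)).pow_right m
    rw [← hcg.eq, e2, inv_mul_cancel_left, map_mul, map_pow (toGroup M) (delta M X ^ 2) n]

/-- Every element of the group is positive up to a power of the central element `Δ_S ^ 2`. -/
theorem exists_central_mul_eq (g : ArtinGroup M) :
    ∃ (z : ArtinGroup M) (x : ArtinMonoid M), (∀ h, Commute h z) ∧ z * g = toGroup M x := by
  obtain ⟨n, p, -, e⟩ := exists_delta_sq_pow_mul_eq (mem_parabolic_univ g)
  exact ⟨_, p, fun h => (commute_delta_sq_of_mem_parabolic (mem_parabolic_univ h)).pow_right n, e⟩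

theorem isDelta_delta (X : Set S) : IsDelta M X (toGroup M (delta M X)) := by
  have hmem : toGroup M (delta M X) ∈ parabolicMonoid M X :=
    toGroup_mem_parabolicMonoid_iff.2 (delta_mem X)
  have key : ∀ n ∈ parabolicMonoid M X, ∃ n' ∈ standardMonoid M X, n = toGroup M n' := by
    intro n hn
    rw [parabolicMonoid_eq_map] at hn
    obtain ⟨n', hn', rfl⟩ := hn
    exact ⟨n', hn', rfl⟩
  refine ⟨⟨hmem, ?_, ?_⟩, ⟨hmem, ?_, ?_⟩⟩
  · rintro _ ⟨s, hs, rfl⟩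
    obtain ⟨c, hc⟩ := atom_dvd_delta (M := M) hs
    have hm := delta_mem (M := M) X
    rw [hc, mul_mem_standardMonoid_iff] at hm
    exact ⟨toGroup M c, toGroup_mem_parabolicMonoid_iff.2 hm.2, by rw [hc, map_mul]; rfl⟩
  · intro n hn h
    obtain ⟨n, hn', rfl⟩ := key n hn
    obtain ⟨c, rfl⟩ : delta M X ∣ n := delta_dvd fun s hs => by
      obtain ⟨c, hc, e⟩ := h _ ⟨s, hs, rfl⟩
      obtain ⟨c, -, rfl⟩ := key c hc
      exact ⟨c, toGroup_injective (by rw [e, map_mul]; rfl)⟩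
    exact ⟨toGroup M c, toGroup_mem_parabolicMonoid_iff.2 (mul_mem_standardMonoid_iff.1 hn').2,
      map_mul _ _ _⟩
  · rintro _ ⟨s, hs, rfl⟩
    obtain ⟨c, hc⟩ := delta_eq_mul_atom (M := M) hs
    have hm := delta_mem (M := M) X
    rw [hc, mul_mem_standardMonoid_iff] at hm
    exact ⟨toGroup M c, toGroup_mem_parabolicMonoid_iff.2 hm.1, by rw [hc, map_mul]; rfl⟩
  · intro n hn h
    obtain ⟨n, hn', rfl⟩ := key n hn
    obtain ⟨c, rfl⟩ : ∃ c, n = c * delta M X := exists_eq_mul_delta fun s hs => by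
      obtain ⟨c, hc, e⟩ := h _ ⟨s, hs, rfl⟩
      obtain ⟨c, -, rfl⟩ := key c hc
      exact ⟨c, toGroup_injective (by rw [e, map_mul]; rfl)⟩
    exact ⟨toGroup M c, toGroup_mem_parabolicMonoid_iff.2 (mul_mem_standardMonoid_iff.1 hn').1,
      map_mul _ _ _⟩

theorem IsDelta.eq_delta {X : Set S} {Δ : ArtinGroup M} (h : IsDelta M X Δ) :
    Δ = toGroup M (delta M X) := by
  obtain ⟨c, hc, e⟩ := h.1.dvd_of_common _ (isDelta_delta X).1.mem (isDelta_delta X).1.dvd_of_mem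
  obtain ⟨c', hc', e'⟩ := (isDelta_delta X).1.dvd_of_common _ h.1.mem h.1.dvd_of_mem
  rw [parabolicMonoid_eq_map] at hc hc'
  obtain ⟨c, -, rfl⟩ := hc
  obtain ⟨c', -, rfl⟩ := hc'
  rw [e', ← map_mul, ← map_mul] at e
  have := congrArg len (toGroup_injective e)
  simp only [len_mul] at this
  rw [e', len_eq_zero.1 (show len c' = 0 by omega), map_one, mul_one]

/-! ### Normalizers, commensurators and centralizers -/

/-- If `g` conjugates a positive power of `Δ_X ^ 2` into `A_X`, then `g` is a product of an
element of `A_X` and an element of the quasi-centralizer. -/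
theorem mem_mul_quasiCentralizer [Finite S] {X : Set S} {g : ArtinGroup M} {k : ℕ} (hk : k ≠ 0)
    (h : g * toGroup M (delta M X ^ 2) ^ k * g⁻¹ ∈ parabolic M X) :
    g ∈ (parabolic M X : Set (ArtinGroup M)) * quasiCentralizer (gens M X) := by
  obtain ⟨k, rfl⟩ := Nat.exists_eq_succ_of_ne_zero hk
  obtain ⟨z, x, hz, e⟩ := exists_central_mul_eq g
  obtain ⟨m, p, hp, e'⟩ := exists_delta_sq_pow_mul_eq h
  have hx : (delta M X ^ 2) ^ m * x * (delta M X ^ 2) ^ (k + 1) = p * x := by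
    apply toGroup_injective
    rw [map_mul, map_mul, map_mul, ← e, ← e', map_pow, map_pow _ _ (k + 1)]
    have h1 := (hz (g * toGroup M (delta M X ^ 2) ^ (k + 1) * g⁻¹)).eq
    have h2 : g * toGroup M (delta M X ^ 2) ^ (k + 1) * g⁻¹ * (z * g) =
        z * g * toGroup M (delta M X ^ 2) ^ (k + 1) := by
      rw [← mul_assoc, h1]; group
    rw [mul_assoc (_ ^ m) _ (z * g), h2]
    simp only [mul_assoc]
  obtain ⟨b, hb, r, rfl, hr⟩ := exists_eq_mul_conjugates hp hx
  refine ⟨toGroup M b, toGroup_mem_parabolic hb, z⁻¹ * toGroup M r, ?_, ?_⟩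
  · rw [mem_quasiCentralizer_iff]
    have key : ∀ x y, r * atom M x = atom M y * r →
        z⁻¹ * toGroup M r * gen M x = gen M y * (z⁻¹ * toGroup M r) := by
      intro x y e
      have e2 := congrArg (toGroup M) e
      rw [map_mul, map_mul, toGroup_atom, toGroup_atom] at e2
      rw [mul_assoc, e2, ← mul_assoc, ← mul_assoc, (hz (gen M y)).inv_right.eq]
    refine ⟨fun x hx => ?_, fun y hy => ?_⟩
    · obtain ⟨y, hy, e⟩ := hr.1 x hx
      exact ⟨y, hy, key x y e⟩
    · obtain ⟨x, hx, e⟩ := hr.2 y hy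
      exact ⟨x, hx, key x y e⟩
  · change toGroup M b * (z⁻¹ * toGroup M r) = g
    rw [← mul_assoc, (hz (toGroup M b)).inv_right.eq, mul_assoc, ← map_mul, ← e,
      inv_mul_cancel_left]

theorem commute_delta_of_mem_quasiCentralizer {X : Set S} {g : ArtinGroup M}
    (hg : g ∈ quasiCentralizer (gens M X)) : Commute g (toGroup M (delta M X)) := by
  rw [mem_quasiCentralizer_iff] at hg
  obtain ⟨z, r, hz, e⟩ := exists_central_mul_eq g
  have key : ∀ x y, g * gen M x = gen M y * g → r * atom M x = atom M y * r := by
    intro x y h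
    apply toGroup_injective
    rw [map_mul, map_mul, toGroup_atom, toGroup_atom, ← e, mul_assoc, h, ← mul_assoc,
      ← mul_assoc, (hz (gen M y)).eq]
  have hr : Conjugates r X X := by
    refine ⟨fun x hx => ?_, fun y hy => ?_⟩
    · obtain ⟨y, hy, e⟩ := hg.1 x hx
      exact ⟨y, hy, key x y e⟩
    · obtain ⟨x, hx, e⟩ := hg.2 y hy
      exact ⟨x, hx, key x y e⟩
  have h := congrArg (toGroup M) hr.mul_delta
  rw [map_mul, map_mul, ← e] at h
  refine mul_left_cancel (a := z) ?_
  rw [← mul_assoc, h, ← mul_assoc, ← mul_assoc, (hz _).eq]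

end ArtinTits

open ArtinTits in
theorem mainTheorem1 {S : Type*} [Finite S] (M : CoxeterMatrix S)
    (hM : ArtinTits.IsSpherical M) (X : Set S) :
    (∃! Δ : ArtinTits.ArtinGroup M, ArtinTits.IsDelta M X Δ) ∧
    ∀ Δ : ArtinTits.ArtinGroup M, ArtinTits.IsDelta M X Δ →
      ∃ ε : ℕ,
        IsLeast {n : ℕ | n ∈ ({1, 2} : Set ℕ) ∧
          Δ ^ n ∈ ArtinTits.centerOf (ArtinTits.parabolic M X)} ε ∧
        (Subgroup.centralizer {Δ ^ ε} : Set (ArtinTits.ArtinGroup M)) =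
          (Subgroup.Commensurable.commensurator (ArtinTits.parabolic M X) :
            Set (ArtinTits.ArtinGroup M)) ∧
        (Subgroup.Commensurable.commensurator (ArtinTits.parabolic M X) :
            Set (ArtinTits.ArtinGroup M)) =
          (Subgroup.normalizer (ArtinTits.parabolic M X : Set (ArtinTits.ArtinGroup M)) :
            Set (ArtinTits.ArtinGroup M)) ∧
        (Subgroup.normalizer (ArtinTits.parabolic M X : Set (ArtinTits.ArtinGroup M)) :
            Set (ArtinTits.ArtinGroup M)) =
          ArtinTits.normalizingSet (ArtinTits.gens M X) ∧
        ArtinTits.normalizingSet (ArtinTits.gens M X) =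
          (ArtinTits.parabolic M X : Set (ArtinTits.ArtinGroup M)) *
            ArtinTits.quasiCentralizer (ArtinTits.gens M X) := by
  have : Finite M.Group := hM
  refine ⟨⟨_, isDelta_delta X, fun Δ h => h.eq_delta⟩, ?_⟩
  intro Δ hΔ
  rw [hΔ.eq_delta]
  clear hΔ Δ
  set D := toGroup M (delta M X) with hD
  have hDmem : D ∈ parabolic M X := toGroup_mem_parabolic (delta_mem X)
  have hD2 : toGroup M (delta M X ^ 2) = D ^ 2 := map_pow _ _ _
  have h2 : D ^ 2 ∈ centerOf (parabolic M X) := by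
    refine Subgroup.mem_inf.2 ⟨Subgroup.pow_mem _ hDmem 2, ?_⟩
    rw [Subgroup.mem_centralizer_iff]
    intro h hh
    rw [← hD2]
    exact (commute_delta_sq_of_mem_parabolic hh).eq
  obtain ⟨ε, hε⟩ : ∃ ε, IsLeast {n : ℕ | n ∈ ({1, 2} : Set ℕ) ∧
      D ^ n ∈ centerOf (parabolic M X)} ε := by
    by_cases h1 : D ^ 1 ∈ centerOf (parabolic M X)
    · refine ⟨1, ⟨by simp, h1⟩, ?_⟩
      rintro n ⟨rfl | rfl, -⟩ <;> omega
    · refine ⟨2, ⟨by simp, h2⟩, ?_⟩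
      rintro n ⟨rfl | rfl, hn⟩
      · exact absurd hn h1
      · exact le_rfl
  have hε0 : ε ≠ 0 := by
    rcases hε.1.1 with rfl | rfl <;> simp
  have hcen := (Subgroup.mem_inf.1 hε.1.2).2
  -- the four sets lie between `A_X · QZ(A_X)` and the set of `g` that conjugate a power
  -- of `Δ_X ^ 2` into `A_X`
  have hQN : (parabolic M X : Set (ArtinGroup M)) * quasiCentralizer (gens M X) ⊆
      (Subgroup.normalizer (parabolic M X : Set (ArtinGroup M)) : Set (ArtinGroup M)) := by
    rintro _ ⟨a, ha, q, hq, rfl⟩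
    exact Subgroup.mul_mem _ (Subgroup.le_normalizer ha) (quasiCentralizer_subset_normalizer X hq)
  have hQZ : (parabolic M X : Set (ArtinGroup M)) * quasiCentralizer (gens M X) ⊆
      (Subgroup.centralizer {D ^ ε} : Set (ArtinGroup M)) := by
    rintro _ ⟨a, ha, q, hq, rfl⟩
    refine Subgroup.mul_mem _ ?_ ?_
    · rw [Subgroup.mem_centralizer_singleton_iff]
      exact Subgroup.mem_centralizer_iff.1 hcen a ha
    · rw [Subgroup.mem_centralizer_singleton_iff]
      exact ((commute_delta_of_mem_quasiCentralizer hq).pow_right ε).eq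
  have hNC : (Subgroup.normalizer (parabolic M X : Set (ArtinGroup M)) : Set (ArtinGroup M)) ⊆
      (Subgroup.Commensurable.commensurator (parabolic M X) : Set (ArtinGroup M)) := by
    intro g hg
    rw [SetLike.mem_coe, Subgroup.Commensurable.commensurator_mem_iff]
    have e : ConjAct.toConjAct g • parabolic M X = parabolic M X := by
      apply SetLike.coe_injective
      rw [SetLike.mem_coe, Subgroup.mem_normalizer_iff_conj_image_eq] at hg
      exact hg
    rw [e]
  have hCQ : (Subgroup.Commensurable.commensurator (parabolic M X) : Set (ArtinGroup M)) ⊆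
      (parabolic M X : Set (ArtinGroup M)) * quasiCentralizer (gens M X) := by
    intro g hg
    rw [SetLike.mem_coe, Subgroup.Commensurable.commensurator_mem_iff] at hg
    have hmem : g * D ^ 2 * g⁻¹ ∈ ConjAct.toConjAct g • parabolic M X :=
      ⟨D ^ 2, Subgroup.pow_mem _ hDmem 2, rfl⟩
    obtain ⟨n, hn, -, h⟩ := Subgroup.exists_pow_mem_of_relIndex_ne_zero hg.2 hmem
    refine mem_mul_quasiCentralizer (k := n) hn.ne' ?_
    rw [hD2, ← conj_pow]
    exact h.1
  have hZQ : (Subgroup.centralizer {D ^ ε} : Set (ArtinGroup M)) ⊆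
      (parabolic M X : Set (ArtinGroup M)) * quasiCentralizer (gens M X) := by
    intro g hg
    rw [SetLike.mem_coe, Subgroup.mem_centralizer_singleton_iff] at hg
    refine mem_mul_quasiCentralizer (k := ε) hε0 ?_
    have hg2 : Commute g (D ^ ε) := hg
    rw [hD2, ← pow_mul, mul_comm, pow_mul, (hg2.pow_right 2).eq, mul_inv_cancel_right, ← pow_mul]
    exact Subgroup.pow_mem _ hDmem _
  have hSQ : normalizingSet (gens M X) ⊆
      (parabolic M X : Set (ArtinGroup M)) * quasiCentralizer (gens M X) := by
    intro g hg
    refine mem_mul_quasiCentralizer (k := 1) one_ne_zero ?_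
    rw [hD2, pow_one]
    exact conj_mem_of_mem_normalizingSet hg (Subgroup.pow_mem _ hDmem 2)
  have hNS : (Subgroup.normalizer (parabolic M X : Set (ArtinGroup M)) : Set (ArtinGroup M)) ⊆
      normalizingSet (gens M X) := by
    rintro g hg _ ⟨y, hy, rfl⟩
    exact ⟨g * y * g⁻¹, (Subgroup.mem_normalizer_iff.1 hg y).1 (Subgroup.subset_closure hy),
      by simp⟩
  exact ⟨ε, hε, (hZQ.trans (hQN.trans hNC)).antisymm (hCQ.trans hQZ),
    (hCQ.trans hQN).antisymm hNC, hNS.antisymm (hSQ.trans hQN), hSQ.antisymm (hQN.trans hNS)⟩
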